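/- **Proposition p1.1 (well-posedness).** Let $\alpha\in\mathbb R$ with $\alpha<-d/2$ and let $m_0,\nu_0>0$. Let $H^{0,\alpha}$ be the space of real functions on $\mathbb R^d$ with $\|\pi\|_{0,\alpha}^2=\int(1+|x|^2)^\alpha|\pi(x)|^2\,dx<\infty$, let $H^{1,\alpha}$ be the space of real functions with weak gradient such that $\|\psi\|_{1,\alpha}^2=\int(1+|x|^2)^\alpha\big(|\psi(x)|^2+|\nabla\psi(x)|^2\big)\,dx<\infty$, and let $L^\alpha$ be the space of $u:\mathbb Z^d\to\mathbb R^n$ with $\|u\|_\alpha^2=\sum_k(1+|k|^2)^\alpha|u(k)|^2<\infty$. Let $\mathcal E=\mathcal E^{0,\alpha}=H^{1,\alpha}\oplus L^\alpha\oplus H^{0,\alpha}\oplus L^\alpha$ be the Hilbert space of vectors $Y=(\psi,u,\pi,v)$ with norm $\|Y\|_{0,\alpha}^2=\|\psi\|_{1,\alpha}^2+\|u\|_\alpha^2+\|\pi\|_{0,\alpha}^2+\|v\|_\alpha^2$. Let $R:\mathbb R^d\to\mathbb R^n$ satisfy the following conditions. * **R1.** $R\in C^\infty(\mathbb R^d)$,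 and $|R(x)|\le\bar R e^{-\varepsilon|x|}$ for some $\varepsilon>0$ and $\bar R<\infty$. * **R2.** For some $\kappa>0$, all $\theta\in[0,2\pi]^d$ and all $X=(\varphi,u)\in H^1(\mathbb T^d;\mathbb C)\oplus\mathbb C^n$, $\mathbb T^d=\mathbb R^d/\mathbb Z^d$, one has $(X,\tilde{\mathcal H}(\theta)X)\ge\kappa^2\big(\|\varphi\|_{H^1(\mathbb T^d)}^2+|u|^2\big)$, where $$(X,\tilde{\mathcal H}(\theta)X)=\int_{\mathbb T^d}\Big(|(i\nabla+\theta)\varphi|^2+m_0^2|\varphi|^2+2\,\mathrm{Re}\big(\overline{\varphi}\,\tilde R_\Pi(\theta,y)\cdot u\big)\Big)dy+\omega_*^2(\theta)|u|^2,$$ $\tilde R_\Pi(\theta,y)=e^{iy\cdot\theta}\sum_{k\in\mathbb Z^d}e^{ik\cdot\theta}R(k+y)$ and $\omega_*^2(\theta)=\sum_{j=1}^d2(1-\cos\theta_j)+\nu_0^2$. Consider the Cauchy problem for the coupled field–crystal system $$\dot\psi=\pi,\qquad \dot u=v,\qquad \dot\pi=(\Delta-m_0^2)\psi-\sum_{k\in\mathbb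 Z^d}u(k,t)\cdot R(x-k),\qquad \dot v(k,t)=(\Delta_L-\nu_0^2)u(k,t)-\int_{\mathbb R^d}R(x-k)\psi(x,t)\,dx,$$ $t\in\mathbb R$, $Y(0)=Y_0$, where $\Delta_Lu(k)=\sum_{|e|=1}(u(k+e)-u(k))$; the equations for $\psi$ and $\pi$ are understood in the sense of distributions in $x$ (after pairing with any test function in $C_0^\infty(\mathbb R^d)$ they hold for every $t$). (i) For every $Y_0\in\mathcal E$ there is a unique solution $Y\in C(\mathbb R,\mathcal E)$ of the Cauchy problem. (ii) The operator $W(t):Y_0\mapsto Y(t)$ is continuous on $\mathcal E$ for every $t\in\mathbb R$. If $\alpha$ is an even integer and $\alpha\le-2$, then for every $T>0$ there is a constant $C(T)$ such that $\sup_{|t|\le T}\|W(t)Y_0\|_{0,\alpha}\le C(T)\|Y_0\|_{0,\alpha}$ for all $Y_0\in\mathcal E$. -/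

import Mathlib

open MeasureTheory

open scoped ENNReal ContDiff Laplacian

noncomputable section

namespace FieldCrystal

/-- The Euclidean space `ℝ^d`. -/
abbrev Space (d : ℕ) : Type := EuclideanSpace ℝ (Fin d)

/-- The lattice `ℤ^d`. -/
abbrev Lattice (d : ℕ) : Type := Fin d → ℤ

/-- The lattice point `k ∈ ℤ^d` as a point of `ℝ^d`. -/
def toSpace {d : ℕ} (k : Lattice d) : Space d := WithLp.toLp 2 fun j => (k j : ℝ)

/-- The `j`-th coordinate vector of `ℝ^d`. -/
def basisVec {d : ℕ} (j : Fin d) : Space d := EuclideanSpace.single j 1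

/-- The weight `(1 + |x|²)^α`. -/
def weight {d : ℕ} (α : ℝ) (x : Space d) : ℝ := (1 + ‖x‖ ^ 2) ^ α

theorem weight_pos {d : ℕ} (α : ℝ) (x : Space d) : 0 < weight α x :=
  Real.rpow_pos_of_pos (by positivity) α

theorem continuous_weight {d : ℕ} (α : ℝ) : Continuous (weight (d := d) α) :=
  (continuous_const.add (continuous_norm.pow 2)).rpow_const
    fun x => Or.inl (show (1 : ℝ) + ‖x‖ ^ 2 ≠ 0 by positivity)

/-- The measure `(1 + |x|²)^α dx` on `ℝ^d`. -/
def fieldMeasure (d : ℕ) (α : ℝ) : Measure (Space d) :=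
  volume.withDensity fun x => ENNReal.ofReal (weight α x)

/-- The measure on `ℤ^d` that gives the point `k` the mass `(1 + |k|²)^α`. -/
def latticeMeasure (d : ℕ) (α : ℝ) : Measure (Lattice d) :=
  Measure.count.withDensity fun k => ENNReal.ofReal (weight α (toSpace k))

/-- `H^{0,α}(ℝ^d)`: real functions with `‖ψ‖² = ∫ (1 + |x|²)^α |ψ(x)|² dx < ∞`. -/
abbrev H0 (d : ℕ) (α : ℝ) : Type := Lp ℝ 2 (fieldMeasure d α)

/-- Vector fields `g : ℝ^d → ℝ^d` with `∫ (1 + |x|²)^α |g(x)|² dx < ∞`. -/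
abbrev H0Vec (d : ℕ) (α : ℝ) : Type := Lp (Space d) 2 (fieldMeasure d α)

/-- `L^α`: functions `u : ℤ^d → ℝ^n` with `‖u‖² = ∑ (1 + |k|²)^α |u(k)|² < ∞`.
Every point of `ℤ^d` has positive mass, so the values `u k` are well defined. -/
abbrev LatticeSpace (d n : ℕ) (α : ℝ) : Type :=
  Lp (EuclideanSpace ℝ (Fin n)) 2 (latticeMeasure d α)

/-- Test functions: `C_0^∞(ℝ^d)`. -/
def IsTest {d : ℕ} (φ : Space d → ℝ) : Prop := ContDiff ℝ ∞ φ ∧ HasCompactSupport φ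

/-- `g` is the weak (distributional) gradient of `ψ` on `ℝ^d`. -/
def IsWeakGradient {d : ℕ} (ψ : Space d → ℝ) (g : Space d → Space d) : Prop :=
  ∀ φ : Space d → ℝ, IsTest φ → ∀ j : Fin d,
    ∫ x, ψ x * fderiv ℝ φ x (basisVec j) = -∫ x, g x j * φ x

theorem fieldMeasure_ae {d : ℕ} {α : ℝ} {p : Space d → Prop}
    (h : ∀ᵐ x ∂(fieldMeasure d α), p x) : ∀ᵐ x, p x := by
  have hm : Measurable fun x : Space d => ENNReal.ofReal (weight α x) :=
    (continuous_weight α).measurable.ennreal_ofReal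
  have h' := (ae_withDensity_iff hm).1 h
  filter_upwards [h'] with x hx
  exact hx (by simpa using weight_pos α x)

instance {d : ℕ} {α : ℝ} : IsLocallyFiniteMeasure (fieldMeasure d α) :=
  IsLocallyFiniteMeasure.withDensity_ofReal (continuous_weight α)

theorem integrable_mul_of_compact {d : ℕ} {α : ℝ} {f : Space d → ℝ}
    (hf : MemLp f 2 (fieldMeasure d α)) {φ : Space d → ℝ} (hφ : Continuous φ)
    (hc : HasCompactSupport φ) : Integrable fun x => f x * φ x := by
  have hq : Continuous fun x => φ x / weight α x :=
    hφ.div (continuous_weight α) fun x => (weight_pos α x).ne'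
  have hqc : HasCompactSupport fun x => φ x / weight α x := by
    simp only [div_eq_mul_inv]
    exact hc.mul_right (f' := fun x => (weight α x)⁻¹)
  have hi : Integrable (fun x => f x * (φ x / weight α x)) (fieldMeasure d α) :=
    hf.integrable_mul (q := 2) (hq.memLp_of_hasCompactSupport hqc)
  have hm : Measurable fun x : Space d => ENNReal.ofReal (weight α x) :=
    (continuous_weight α).measurable.ennreal_ofReal
  refine ((integrable_withDensity_iff_integrable_smul' hm
    (Filter.Eventually.of_forall fun x => ENNReal.ofReal_lt_top)).1 hi).congr
    (Filter.Eventually.of_forall fun x => ?_)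
  have hw := weight_pos α x
  simp only [ENNReal.toReal_ofReal hw.le, smul_eq_mul]
  field_simp

theorem continuous_partial {d : ℕ} {φ : Space d → ℝ} (hφ : IsTest φ) (j : Fin d) :
    Continuous fun x => fderiv ℝ φ x (basisVec j) :=
  (hφ.1.continuous_fderiv (by simp)).clm_apply continuous_const

theorem compact_partial {d : ℕ} {φ : Space d → ℝ} (hφ : IsTest φ) (j : Fin d) :
    HasCompactSupport fun x => fderiv ℝ φ x (basisVec j) :=
  hφ.2.fderiv_apply (𝕜 := ℝ) (basisVec j)

theorem memLp_coord {d : ℕ} {α : ℝ} (g : H0Vec d α) (j : Fin d) :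
    MemLp (fun x => g x j) 2 (fieldMeasure d α) :=
  (EuclideanSpace.proj (𝕜 := ℝ) j : Space d →L[ℝ] ℝ).comp_memLp' (Lp.memLp g)

/-- `H^{1,α}(ℝ^d)`, the weighted Sobolev space, realised as the space of pairs `(ψ, ∇ψ)`
with `ψ` and its weak gradient in the weighted `L²` spaces. Its norm is
`‖ψ‖² = ∫ (1 + |x|²)^α (|ψ(x)|² + |∇ψ(x)|²) dx`. -/
def H1 (d : ℕ) (α : ℝ) : Submodule ℝ (WithLp 2 (H0 d α × H0Vec d α)) where
  carrier := {p | IsWeakGradient p.fst p.snd}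
  zero_mem' := by
    intro φ _ j
    have h1 : ∀ᵐ x, (0 : H0 d α) x = 0 := fieldMeasure_ae (Lp.coeFn_zero ℝ 2 _)
    have h2 : ∀ᵐ x, (0 : H0Vec d α) x = 0 := fieldMeasure_ae (Lp.coeFn_zero (Space d) 2 _)
    have e1 : ∫ x, (0 : H0 d α) x * fderiv ℝ φ x (basisVec j) = 0 :=
      integral_eq_zero_of_ae (by filter_upwards [h1] with x hx; rw [hx]; simp)
    have e2 : ∫ x, (0 : H0Vec d α) x j * φ x = 0 :=
      integral_eq_zero_of_ae (by filter_upwards [h2] with x hx; rw [hx]; simp)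
    change ∫ x, (0 : H0 d α) x * fderiv ℝ φ x (basisVec j) =
      -∫ x, (0 : H0Vec d α) x j * φ x
    rw [e1, e2, neg_zero]
  add_mem' := by
    intro p q hp hq φ hφ j
    have h1 := fieldMeasure_ae (Lp.coeFn_add p.fst q.fst)
    have h2 := fieldMeasure_ae (Lp.coeFn_add p.snd q.snd)
    have e1 : ∫ x, (p.fst + q.fst) x * fderiv ℝ φ x (basisVec j) =
        (∫ x, p.fst x * fderiv ℝ φ x (basisVec j)) +
          ∫ x, q.fst x * fderiv ℝ φ x (basisVec j) := by
      rw [← integral_add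
        (integrable_mul_of_compact (Lp.memLp p.fst) (continuous_partial hφ j)
          (compact_partial hφ j))
        (integrable_mul_of_compact (Lp.memLp q.fst) (continuous_partial hφ j)
          (compact_partial hφ j))]
      refine integral_congr_ae ?_
      filter_upwards [h1] with x hx
      simp only [hx, Pi.add_apply, add_mul]
    have e2 : ∫ x, (p.snd + q.snd) x j * φ x =
        (∫ x, p.snd x j * φ x) + ∫ x, q.snd x j * φ x := by
      rw [← integral_add
        (integrable_mul_of_compact (memLp_coord p.snd j) hφ.1.continuous hφ.2)
        (integrable_mul_of_compact (memLp_coord q.snd j) hφ.1.continuous hφ.2)]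
      refine integral_congr_ae ?_
      filter_upwards [h2] with x hx
      simp only [hx, Pi.add_apply, PiLp.add_apply, add_mul]
    change ∫ x, (p.fst + q.fst) x * fderiv ℝ φ x (basisVec j) =
      -∫ x, (p.snd + q.snd) x j * φ x
    rw [e1, e2, hp φ hφ j, hq φ hφ j]
    ring
  smul_mem' := by
    intro c p hp φ hφ j
    have h1 := fieldMeasure_ae (Lp.coeFn_smul c p.fst)
    have h2 := fieldMeasure_ae (Lp.coeFn_smul c p.snd)
    have e1 : ∫ x, (c • p.fst) x * fderiv ℝ φ x (basisVec j) =
        c * ∫ x, p.fst x * fderiv ℝ φ x (basisVec j) := by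
      rw [← integral_const_mul]
      refine integral_congr_ae ?_
      filter_upwards [h1] with x hx
      simp only [hx, Pi.smul_apply, smul_eq_mul, mul_assoc]
    have e2 : ∫ x, (c • p.snd) x j * φ x = c * ∫ x, p.snd x j * φ x := by
      rw [← integral_const_mul]
      refine integral_congr_ae ?_
      filter_upwards [h2] with x hx
      simp only [hx, Pi.smul_apply, PiLp.smul_apply, smul_eq_mul, mul_assoc]
    change ∫ x, (c • p.fst) x * fderiv ℝ φ x (basisVec j) =
      -∫ x, (c • p.snd) x j * φ x
    rw [e1, e2, hp φ hφ j]
    ring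

/-- The phase space `𝓔 = H^{1,α} ⊕ L^α ⊕ H^{0,α} ⊕ L^α` of vectors `Y = (ψ, u, π, v)`, with
the Hilbert norm `‖Y‖² = ‖ψ‖² + ‖u‖² + ‖π‖² + ‖v‖²`. -/
abbrev PhaseSpace (d n : ℕ) (α : ℝ) : Type :=
  WithLp 2 (WithLp 2 (H1 d α × LatticeSpace d n α) × WithLp 2 (H0 d α × LatticeSpace d n α))

variable {d n : ℕ} {α : ℝ}

/-- The field `ψ`. -/
def fieldOf (Y : PhaseSpace d n α) : Space d → ℝ := (Y.fst.fst : WithLp 2 (H0 d α × H0Vec d α)).fst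

/-- The displacements `u`. -/
def dispOf (Y : PhaseSpace d n α) : Lattice d → EuclideanSpace ℝ (Fin n) := Y.fst.snd

/-- The momentum `π` of the field. -/
def momOf (Y : PhaseSpace d n α) : Space d → ℝ := Y.snd.fst

/-- The velocities `v`. -/
def velOf (Y : PhaseSpace d n α) : Lattice d → EuclideanSpace ℝ (Fin n) := Y.snd.snd

/-- The discrete Laplacian `Δ_L u(k) = ∑_{|e| = 1} (u(k + e) - u(k))`; the unit vectors of
`ℤ^d` are `± e_j`. -/
def latticeLaplacian (u : Lattice d → EuclideanSpace ℝ (Fin n)) (k : Lattice d) :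
    EuclideanSpace ℝ (Fin n) :=
  ∑ j : Fin d, ((u (k + Pi.single j 1) - u k) + (u (k - Pi.single j 1) - u k))

/-- `(S u)(x) = ∑_k R(x - k) · u(k)`. -/
def couplingS (R : Space d → EuclideanSpace ℝ (Fin n))
    (u : Lattice d → EuclideanSpace ℝ (Fin n)) (x : Space d) : ℝ :=
  ∑' k : Lattice d, inner ℝ (R (x - toSpace k)) (u k)

/-- `(S^* ψ)(k) = ∫ R(x - k) ψ(x) dx`. -/
def couplingSAdj (R : Space d → EuclideanSpace ℝ (Fin n)) (ψ : Space d → ℝ) (k : Lattice d) :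
    EuclideanSpace ℝ (Fin n) :=
  ∫ x, ψ x • R (x - toSpace k)

/-- `Y` solves the Cauchy problem
`ψ' = π`, `u' = v`, `π' = (Δ - m₀²) ψ - S u`, `v' = (Δ_L - ν₀²) u - S^* ψ`, `Y(0) = Y₀`,
where the field equations are understood in the sense of distributions on `ℝ^d`. -/
structure IsSolution (R : Space d → EuclideanSpace ℝ (Fin n)) (m₀ ν₀ : ℝ)
    (Y₀ : PhaseSpace d n α) (Y : ℝ → PhaseSpace d n α) : Prop where
  initial : Y 0 = Y₀
  field_eq : ∀ φ : Space d → ℝ, IsTest φ → ∀ t : ℝ,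
    HasDerivAt (fun s => ∫ x, fieldOf (Y s) x * φ x) (∫ x, momOf (Y t) x * φ x) t
  disp_eq : ∀ (k : Lattice d) (t : ℝ),
    HasDerivAt (fun s => dispOf (Y s) k) (velOf (Y t) k) t
  mom_eq : ∀ φ : Space d → ℝ, IsTest φ → ∀ t : ℝ,
    HasDerivAt (fun s => ∫ x, momOf (Y s) x * φ x)
      ((∫ x, fieldOf (Y t) x * (Δ φ x - m₀ ^ 2 * φ x)) -
        ∫ x, couplingS R (dispOf (Y t)) x * φ x) t
  vel_eq : ∀ (k : Lattice d) (t : ℝ),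
    HasDerivAt (fun s => velOf (Y s) k)
      (latticeLaplacian (dispOf (Y t)) k - ν₀ ^ 2 • dispOf (Y t) k -
        couplingSAdj R (fieldOf (Y t)) k) t

/-- Condition R1: `R` is smooth and decays exponentially. -/
def ConditionR1 (R : Space d → EuclideanSpace ℝ (Fin n)) : Prop :=
  ContDiff ℝ ∞ R ∧ ∃ ε > 0, ∃ Rbar : ℝ, ∀ x, ‖R x‖ ≤ Rbar * Real.exp (-ε * ‖x‖)

/-- The unit cell `[0,1]^d`. -/
def unitCell (d : ℕ) : Set (Space d) := {y | ∀ j, y j ∈ Set.Icc (0 : ℝ) 1}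

/-- `ℤ^d`-periodicity, so that `f` is a function on the torus `ℝ^d / ℤ^d`. -/
def IsPeriodic {F : Type*} (f : Space d → F) : Prop :=
  ∀ (k : Lattice d) (y : Space d), f (y + toSpace k) = f y

/-- `φ` belongs to the Sobolev space `H¹` of the torus `ℝ^d / ℤ^d` (complex valued), with weak
gradient `g`. -/
structure IsTorusH1 (φ : Space d → ℂ) (g : Space d → EuclideanSpace ℂ (Fin d)) : Prop where
  periodic : IsPeriodic φ
  periodic_grad : IsPeriodic g
  memLp : MemLp φ 2 (volume.restrict (unitCell d))
  memLp_grad : MemLp g 2 (volume.restrict (unitCell d))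
  weak_grad : ∀ χ : Space d → ℂ, ContDiff ℝ ∞ χ → IsPeriodic χ → ∀ j : Fin d,
    ∫ y in unitCell d, φ y * fderiv ℝ χ y (basisVec j) = -∫ y in unitCell d, g y j * χ y

/-- The Zak transform of the coupling function, componentwise:
`R_Π(θ, y) = e^{i y·θ} ∑_k e^{i k·θ} R(k + y)`. -/
def zakCoupling (R : Space d → EuclideanSpace ℝ (Fin n)) (θ y : Space d) (i : Fin n) : ℂ :=
  Complex.exp (Complex.I * (inner ℝ y θ : ℝ)) *
    ∑' k : Lattice d,
      Complex.exp (Complex.I * (inner ℝ (toSpace k) θ : ℝ)) * (R (toSpace k + y) i : ℂ)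

/-- `ω_*²(θ) = ∑_j 2 (1 - cos θ_j) + ν₀²`. -/
def omegaStarSq (ν₀ : ℝ) (θ : Space d) : ℝ := (∑ j, 2 * (1 - Real.cos (θ j))) + ν₀ ^ 2

/-- The quadratic form `(X, H(θ) X)`, `X = (φ, u)`, of the operator
`H(θ) = [[(i∇ + θ)² + m₀², S(θ)], [S(θ)^*, ω_*²(θ)]]` on the torus, where
`S(θ) u = R_Π(θ, ·) · u`, and `g` is the gradient of `φ`. -/
def blochForm (R : Space d → EuclideanSpace ℝ (Fin n)) (m₀ ν₀ : ℝ) (θ : Space d)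
    (φ : Space d → ℂ) (g : Space d → EuclideanSpace ℂ (Fin d)) (u : EuclideanSpace ℂ (Fin n)) :
    ℝ :=
  (∫ y in unitCell d,
    ((∑ j, ‖Complex.I * g y j + (θ j : ℂ) * φ y‖ ^ 2) + m₀ ^ 2 * ‖φ y‖ ^ 2 +
      2 * ((starRingEnd ℂ) (φ y) * ∑ i, zakCoupling R θ y i * u i).re)) +
    omegaStarSq ν₀ θ * ‖u‖ ^ 2

/-- Condition R2: `H(θ)` is positive definite for `θ ∈ [0, 2π]^d`, that is,
`(X, H(θ) X) ≥ κ² ‖X‖²` with the norm of `H¹ ⊕ ℂ^n` on the right. -/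
def ConditionR2 (R : Space d → EuclideanSpace ℝ (Fin n)) (m₀ ν₀ : ℝ) : Prop :=
  ∃ κ > 0, ∀ θ : Space d, (∀ j, θ j ∈ Set.Icc (0 : ℝ) (2 * Real.pi)) →
    ∀ (φ : Space d → ℂ) (g : Space d → EuclideanSpace ℂ (Fin d)) (u : EuclideanSpace ℂ (Fin n)),
      IsTorusH1 φ g →
        κ ^ 2 * ((∫ y in unitCell d, (‖φ y‖ ^ 2 + ‖g y‖ ^ 2)) + ‖u‖ ^ 2) ≤
          blochForm R m₀ ν₀ θ φ g u

end FieldCrystal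

end

/-!
Write the system as `Y' = A Y + B Y`, where `A` is the free wave operator `(ψ, π) ↦ (π, Δψ)` on the
field components and `B` collects the mass terms, the identity `u' = v`, the lattice Laplacian and
the coupling.

Both `A` and `-A` are quasi-dissipative: integrating by parts in `⟨A Y, Y⟩` leaves only lower-order
terms, because the logarithmic derivative of the weight `(1 + |x|²)^α` is bounded by `|α|`. The
resolvent of `A` amounts to solving `λ² ψ - Δψ = f` in the weighted spaces, where the weak form is
coercive for large `λ`. Hence the Yosida approximations converge to a group with
`‖exp (t A)‖ ≤ exp (c |t|)`.

The operator `B` is bounded: by Peetre's inequality `w_α(x) ≤ 2^|α| w_|α|(x - y) w_α(y)` for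
`w_α(x) = (1 + |x|²)^α`, the coupling passes the Schur test as soon as `R = O(w_(-s))` with
`s > d / 2 + |α|`. A bounded perturbation of a group generator is again one, and the distributional
solutions of the Cauchy problem are exactly the mild solutions for the perturbed generator.
-/

noncomputable section

namespace FieldCrystal

open Filter Set Topology

open scoped NNReal Gradient

/-! ### Quasi-contraction groups and mild solutions -/

section Resolvent

variable {E : Type*} [NormedAddCommGroup E] [InnerProductSpace ℝ E]
  {Γ : Submodule ℝ (E × E)} {lam mu : ℝ} {J K : E →L[ℝ] E}

/-- `J` is the resolvent `(lam - A)⁻¹` of the operator `A` whose graph is `Γ`. -/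
def IsResolvent (Γ : Submodule ℝ (E × E)) (lam : ℝ) (J : E →L[ℝ] E) : Prop :=
  ∀ p : E × E, p ∈ Γ ↔ J (lam • p.1 - p.2) = p.1

/-- The Yosida approximation `lam (lam J - 1) = lam A (lam - A)⁻¹` of `A`, where `J` is the
resolvent of `A` at `lam`. -/
def yosida (lam : ℝ) (J : E →L[ℝ] E) : E →L[ℝ] E := lam • (lam • J - 1)

theorem yosida_apply (lam : ℝ) (J : E →L[ℝ] E) (z : E) :
    yosida lam J z = lam • (lam • J z - z) := rfl

namespace IsResolvent

theorem isClosed (h : IsResolvent Γ lam J) : IsClosed (Γ : Set (E × E)) := by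
  have hΓ : (Γ : Set (E × E)) = {p | J (lam • p.1 - p.2) = p.1} := Set.ext h
  rw [hΓ]
  exact isClosed_eq (by fun_prop) continuous_fst

theorem mk_mem (h : IsResolvent Γ lam J) (z : E) : (J z, lam • J z - z) ∈ Γ :=
  (h _).2 (congrArg J (sub_sub_cancel _ z))

theorem smul_apply_sub (h : IsResolvent Γ lam J) {p : E × E} (hp : p ∈ Γ) :
    lam • J p.1 - p.1 = J p.2 := by
  have hJ := (h p).1 hp
  rw [map_sub, map_smul] at hJ
  rw [sub_eq_iff_eq_add, ← sub_eq_iff_eq_add', hJ]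

theorem sub_apply (hJ : IsResolvent Γ lam J) (hK : IsResolvent Γ mu K) (z : E) :
    J z - K z = (mu - lam) • J (K z) := by
  have h := (hJ _).1 (hK.mk_mem z)
  simp only [map_sub, map_smul] at h
  linear_combination (norm := module) h

theorem commute (hJ : IsResolvent Γ lam J) (hK : IsResolvent Γ mu K) : Commute J K := by
  ext z
  have h₁ := hJ.sub_apply hK z
  have h₂ := hK.sub_apply hJ z
  rcases eq_or_ne lam mu with rfl | hne
  · have hJK : J = K := ContinuousLinearMap.ext fun w => by
      simpa only [sub_self, zero_smul, sub_eq_zero] using hJ.sub_apply hK w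
    rw [hJK]
  · refine smul_right_injective E (sub_ne_zero.2 hne.symm) ?_
    calc (mu - lam) • J (K z) = -(K z - J z) := by rw [← h₁, neg_sub]
      _ = (mu - lam) • K (J z) := by rw [h₂, ← neg_smul, neg_sub]

theorem commute_yosida (hJ : IsResolvent Γ lam J) (hK : IsResolvent Γ mu K) :
    Commute (yosida lam J) (yosida mu K) :=
  have h : Commute (lam • J) (mu • K) := ((hJ.commute hK).smul_left lam).smul_right mu
  (((h.sub_left (Commute.one_left _)).sub_right
    ((Commute.one_right _).sub_left (Commute.one_left _))).smul_left lam).smul_right mu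

theorem mk_smul_yosida_mem (h : IsResolvent Γ lam J) (z : E) :
    (lam • J z, yosida lam J z) ∈ Γ :=
  Γ.smul_mem lam (h.mk_mem z)

theorem yosida_fst (h : IsResolvent Γ lam J) {p : E × E} (hp : p ∈ Γ) :
    yosida lam J p.1 = lam • J p.2 :=
  congrArg (lam • ·) (h.smul_apply_sub hp)

end IsResolvent

/-- The relation `Γ` is the graph of an operator `A` with `⟪A x, x⟫ ≤ c ‖x‖²` such that `lam - A` is
onto for all large real `lam`, as in the Lumer–Phillips theorem. -/
structure IsQuasiContractionGenerator (Γ : Submodule ℝ (E × E)) (c : ℝ≥0) : Prop where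
  inner_le : ∀ p ∈ Γ, inner ℝ p.2 p.1 ≤ c * ‖p.1‖ ^ 2
  surj : ∃ lam₀ : ℝ, ∀ lam, lam₀ < lam → ∀ z, ∃ p ∈ Γ, lam • p.1 - p.2 = z
  eq_zero : ∀ y, ((0 : E), y) ∈ Γ → y = 0

namespace IsQuasiContractionGenerator

variable {c : ℝ≥0}

theorem sub_mul_norm_le (h : IsQuasiContractionGenerator Γ c) (lam : ℝ) {p : E × E} (hp : p ∈ Γ) :
    (lam - c) * ‖p.1‖ ≤ ‖lam • p.1 - p.2‖ := by
  rcases eq_or_ne p.1 0 with h0 | h0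
  · simp [h0]
  have hle : (lam - c) * ‖p.1‖ * ‖p.1‖ ≤ ‖lam • p.1 - p.2‖ * ‖p.1‖ :=
    calc (lam - c) * ‖p.1‖ * ‖p.1‖ = lam * ‖p.1‖ ^ 2 - c * ‖p.1‖ ^ 2 := by ring
      _ ≤ lam * ‖p.1‖ ^ 2 - inner ℝ p.2 p.1 := by gcongr; exact h.inner_le p hp
      _ = inner ℝ (lam • p.1 - p.2) p.1 := by
        rw [inner_sub_left, real_inner_smul_left, real_inner_self_eq_norm_sq]
      _ ≤ ‖lam • p.1 - p.2‖ * ‖p.1‖ := real_inner_le_norm _ _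
  exact le_of_mul_le_mul_right hle (norm_pos_iff.2 h0)

theorem exists_isResolvent_of_surj (h : IsQuasiContractionGenerator Γ c) {lam : ℝ} (hlam : c < lam)
    (hsurj : ∀ z, ∃ p ∈ Γ, lam • p.1 - p.2 = z) : ∃ J, IsResolvent Γ lam J := by
  have hpos : 0 < lam - c := sub_pos.2 hlam
  let D : Γ →ₗ[ℝ] E := (lam • LinearMap.fst ℝ E E - LinearMap.snd ℝ E E).comp Γ.subtype
  have hle (p : Γ) : ‖p.1.1‖ ≤ (lam - c)⁻¹ * ‖D p‖ :=
    (le_inv_mul_iff₀ hpos).2 (h.sub_mul_norm_le lam p.2)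
  have hinj : Function.Injective D := (injective_iff_map_eq_zero D).2 fun p hp => by
    have hp₁ : p.1.1 = 0 := norm_le_zero_iff.1 ((hle p).trans_eq (by rw [hp, norm_zero, mul_zero]))
    have hp₂ : p.1.2 = 0 := h.eq_zero _ (hp₁ ▸ p.2)
    exact Subtype.ext (Prod.ext hp₁ hp₂)
  let e := LinearEquiv.ofBijective D
    ⟨hinj, fun z => let ⟨p, hp, hz⟩ := hsurj z; ⟨⟨p, hp⟩, hz⟩⟩
  refine ⟨LinearMap.mkContinuous ((LinearMap.fst ℝ E E).comp (Γ.subtype.comp e.symm.toLinearMap))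
    (lam - c)⁻¹ fun z => ?_, fun p => ⟨fun hp => ?_, fun hp => ?_⟩⟩
  · exact (hle (e.symm z)).trans_eq (congrArg (fun w => (lam - c)⁻¹ * ‖w‖) (e.apply_symm_apply z))
  · exact congrArg (fun q : Γ => q.1.1) (e.symm_apply_apply ⟨p, hp⟩)
  · set q := e.symm (lam • p.1 - p.2)
    have hq : lam • q.1.1 - q.1.2 = lam • p.1 - p.2 := e.apply_symm_apply _
    have hq₁ : q.1.1 = p.1 := hp
    have hq₂ : q.1.2 = p.2 := by rwa [hq₁, sub_right_inj] at hq
    exact Prod.ext hq₁ hq₂ ▸ q.2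

theorem norm_smul_apply_le (h : IsQuasiContractionGenerator Γ c) (hJ : IsResolvent Γ lam J)
    (hlam : 0 < lam) (hc : 2 * c ≤ lam) (z : E) : ‖lam • J z‖ ≤ 2 * ‖z‖ :=
  calc ‖lam • J z‖ = lam * ‖J z‖ := norm_smul_of_nonneg hlam.le _
    _ ≤ 2 * (lam - c) * ‖J z‖ := by gcongr; linarith
    _ ≤ 2 * ‖z‖ := by
      have := h.sub_mul_norm_le lam (hJ.mk_mem z)
      rw [sub_sub_cancel] at this
      linarith

theorem inner_yosida_le (h : IsQuasiContractionGenerator Γ c) (hJ : IsResolvent Γ lam J)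
    (hlam : 0 < lam) (hc : 2 * c ≤ lam) (z : E) :
    inner ℝ (yosida lam J z) z ≤ 2 * c * ‖z‖ ^ 2 := by
  set y := yosida lam J z with hy
  have hx : lam • J z = z + lam⁻¹ • y := by
    rw [hy, yosida_apply, inv_smul_smul₀ hlam.ne', add_sub_cancel]
  have hmem := h.inner_le _ (hJ.mk_smul_yosida_mem z)
  simp only [← hy, hx, inner_add_right, real_inner_smul_right, real_inner_self_eq_norm_sq] at hmem
  have hadd : ‖z + lam⁻¹ • y‖ ^ 2 ≤ 2 * ‖z‖ ^ 2 + 2 * (lam⁻¹ * ‖y‖) ^ 2 := by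
    rw [← norm_smul_of_nonneg (inv_nonneg.2 hlam.le)]
    nlinarith [norm_add_le z (lam⁻¹ • y), norm_nonneg (z + lam⁻¹ • y),
      sq_nonneg (‖z‖ - ‖lam⁻¹ • y‖)]
  have habsorb : 2 * c * (lam⁻¹ * ‖y‖) ^ 2 ≤ lam⁻¹ * ‖y‖ ^ 2 :=
    calc 2 * c * (lam⁻¹ * ‖y‖) ^ 2 ≤ lam * (lam⁻¹ * ‖y‖) ^ 2 := by gcongr
      _ = lam⁻¹ * ‖y‖ ^ 2 := by field_simp
  have := mul_le_mul_of_nonneg_left hadd c.coe_nonneg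
  linarith

theorem dense_fst [CompleteSpace E] (h : IsQuasiContractionGenerator Γ c) :
    Dense (Γ.map (LinearMap.fst ℝ E E) : Set E) := by
  rw [Submodule.dense_iff_topologicalClosure_eq_top, Submodule.topologicalClosure_eq_top_iff,
    Submodule.eq_bot_iff]
  intro z hz
  obtain ⟨lam₀, hs⟩ := h.surj
  obtain ⟨lam, hlam⟩ := exists_gt (max lam₀ c)
  obtain ⟨p, hp, rfl⟩ := hs lam ((le_max_left _ _).trans_lt hlam) z
  have hlt : c < lam := (le_max_right _ _).trans_lt hlam
  have horth : inner ℝ (lam • p.1 - p.2) p.1 = 0 :=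
    (Submodule.mem_orthogonal' _ _).1 hz p.1 ⟨p, hp, rfl⟩
  rw [inner_sub_left, real_inner_smul_left, real_inner_self_eq_norm_sq] at horth
  have hp₁ : p.1 = 0 := by
    by_contra hne
    have := mul_pos (sub_pos.2 hlt) (pow_pos (norm_pos_iff.2 hne) 2)
    linarith [h.inner_le p hp]
  have hp₂ : p.2 = 0 := h.eq_zero _ (hp₁ ▸ hp)
  rw [hp₁, hp₂, smul_zero, sub_zero]

end IsQuasiContractionGenerator

end Resolvent

section Exponential

variable {E : Type*} [NormedAddCommGroup E] [InnerProductSpace ℝ E]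

theorem norm_le_exp_mul_of_inner_deriv_le {f f' : ℝ → E} {k : ℝ} (hf : ∀ t, HasDerivAt f (f' t) t)
    (hk : ∀ t, 0 ≤ t → inner ℝ (f' t) (f t) ≤ k * ‖f t‖ ^ 2) {t : ℝ} (ht : 0 ≤ t) :
    ‖f t‖ ≤ Real.exp (k * t) * ‖f 0‖ := by
  let g : ℝ → ℝ := fun s => ‖Real.exp (-k * s) • f s‖ ^ 2
  have hg (s : ℝ) : HasDerivAt g (2 * Real.exp (-k * s) ^ 2 *
      (inner ℝ (f' s) (f s) - k * ‖f s‖ ^ 2)) s := by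
    have hexp : HasDerivAt (fun s => Real.exp (-k * s)) (Real.exp (-k * s) * -k) s := by
      simpa using ((hasDerivAt_id s).const_mul (-k)).exp
    refine (hexp.smul (hf s)).norm_sq.congr_deriv ?_
    simp only [Pi.smul_apply']
    rw [inner_add_right, real_inner_smul_left, real_inner_smul_left, real_inner_smul_right,
      real_inner_smul_right, real_inner_self_eq_norm_sq, real_inner_comm]
    ring
  have hanti : AntitoneOn g (Ici 0) :=
    antitoneOn_of_hasDerivWithinAt_nonpos (convex_Ici 0)
      (fun s _ => (hg s).continuousAt.continuousWithinAt) (fun s _ => (hg s).hasDerivWithinAt)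
      fun s hs => mul_nonpos_of_nonneg_of_nonpos (by positivity)
        (sub_nonpos.2 (hk s (interior_subset hs)))
  have hle := abs_le_of_sq_le_sq (hanti self_mem_Ici (mem_Ici.2 ht) ht) (norm_nonneg _)
  rw [abs_norm, norm_smul, Real.norm_of_nonneg (Real.exp_pos _).le, mul_zero, Real.exp_zero,
    one_smul, neg_mul, Real.exp_neg, inv_mul_le_iff₀ (Real.exp_pos _)] at hle
  exact hle

theorem exp_zero_smul_apply (A : E →L[ℝ] E) (x : E) : NormedSpace.exp ((0 : ℝ) • A) x = x := by
  rw [zero_smul, NormedSpace.exp_zero, one_apply_eq_self]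

variable [CompleteSpace E] {A B : E →L[ℝ] E} {k : ℝ}

theorem hasDerivAt_exp_smul_apply (A : E →L[ℝ] E) (x : E) (t : ℝ) :
    HasDerivAt (fun s : ℝ => NormedSpace.exp (s • A) x) (A (NormedSpace.exp (t • A) x)) t := by
  simpa only [mul_apply_eq_comp, map_zero, add_zero] using
    (hasDerivAt_exp_smul_const' (𝕂 := ℝ) A t).clm_apply (hasDerivAt_const t x)

theorem continuous_exp_smul_apply (A : E →L[ℝ] E) (x : E) :
    Continuous fun t : ℝ => NormedSpace.exp (t • A) x :=
  continuous_iff_continuousAt.2 fun t => (hasDerivAt_exp_smul_apply A x t).continuousAt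

theorem norm_exp_smul_apply_le (hA : ∀ z, inner ℝ (A z) z ≤ k * ‖z‖ ^ 2) (x : E) {t : ℝ}
    (ht : 0 ≤ t) : ‖NormedSpace.exp (t • A) x‖ ≤ Real.exp (k * t) * ‖x‖ := by
  simpa only [exp_zero_smul_apply] using
    norm_le_exp_mul_of_inner_deriv_le (hasDerivAt_exp_smul_apply A x) (fun s _ => hA _) ht

theorem norm_exp_smul_sub_exp_smul_le (hA : ∀ z, inner ℝ (A z) z ≤ k * ‖z‖ ^ 2)
    (hB : ∀ z, inner ℝ (B z) z ≤ k * ‖z‖ ^ 2) (hAB : Commute A B) (x : E) {t : ℝ} (ht : 0 ≤ t) :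
    ‖NormedSpace.exp (t • A) x - NormedSpace.exp (t • B) x‖ ≤
      Real.exp (k * t) * ‖A x - B x‖ * t := by
  have hderiv (s : ℝ) : HasDerivAt
      (fun s : ℝ => NormedSpace.exp ((t - s) • B) (NormedSpace.exp (s • A) x))
      (NormedSpace.exp ((t - s) • B) (NormedSpace.exp (s • A) (A x - B x))) s := by
    have hB' : HasDerivAt (fun s : ℝ => NormedSpace.exp ((t - s) • B))
        (-(NormedSpace.exp ((t - s) • B) * B)) s := by
      simpa [Function.comp_def] using (hasDerivAt_exp_smul_const (𝕂 := ℝ) B (t - s)).scomp s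
        ((hasDerivAt_const s t).sub (hasDerivAt_id s))
    have hA' : HasDerivAt (fun s : ℝ => NormedSpace.exp (s • A) x)
        (NormedSpace.exp (s • A) (A x)) s := by
      simpa using (hasDerivAt_exp_smul_const (𝕂 := ℝ) A s).clm_apply (hasDerivAt_const s x)
    have hcomm : B (NormedSpace.exp (s • A) x) = NormedSpace.exp (s • A) (B x) :=
      congrArg (fun C : E →L[ℝ] E => C x) (hAB.symm.smul_right s).exp_right.eq
    convert hB'.clm_apply hA' using 1
    rw [neg_apply, mul_apply_eq_comp, hcomm, map_sub, map_sub]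
    abel
  have hbound (s : ℝ) (hs : s ∈ Icc 0 t) :
      ‖NormedSpace.exp ((t - s) • B) (NormedSpace.exp (s • A) (A x - B x))‖ ≤
        Real.exp (k * t) * ‖A x - B x‖ :=
    calc ‖NormedSpace.exp ((t - s) • B) (NormedSpace.exp (s • A) (A x - B x))‖
      _ ≤ Real.exp (k * (t - s)) * (Real.exp (k * s) * ‖A x - B x‖) :=
        (norm_exp_smul_apply_le hB _ (sub_nonneg.2 hs.2)).trans
          (mul_le_mul_of_nonneg_left (norm_exp_smul_apply_le hA _ hs.1) (Real.exp_pos _).le)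
      _ = Real.exp (k * t) * ‖A x - B x‖ := by
        rw [← mul_assoc, ← Real.exp_add]
        ring_nf
  simpa [abs_of_nonneg ht] using (convex_Icc 0 t).norm_image_sub_le_of_norm_hasDerivWithin_le
    (fun s _ => (hderiv s).hasDerivWithinAt) hbound (left_mem_Icc.2 ht) (right_mem_Icc.2 ht)

end Exponential

theorem tendsto_apply_zero_of_dense {ι E F : Type*} [SeminormedAddCommGroup E] [NormedSpace ℝ E]
    [SeminormedAddCommGroup F] [NormedSpace ℝ F] {l : Filter ι} {Φ : ι → E →L[ℝ] F} {C : ℝ}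
    (hC : ∀ᶠ i in l, ∀ x, ‖Φ i x‖ ≤ C * ‖x‖) {S : Set E} (hS : Dense S)
    (h : ∀ y ∈ S, Tendsto (fun i => Φ i y) l (𝓝 0)) (x : E) :
    Tendsto (fun i => Φ i x) l (𝓝 0) := by
  refine Metric.tendsto_nhds.2 fun ε hε => ?_
  obtain ⟨y, hyS, hxy⟩ := hS.exists_dist_lt x (ε := ε / 2 / (|C| + 1)) (by positivity)
  filter_upwards [hC, Metric.tendsto_nhds.1 (h y hyS) (ε / 2) (half_pos hε)] with i hi hy
  rw [dist_zero_right] at hy ⊢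
  rw [dist_eq_norm, lt_div_iff₀ (by positivity)] at hxy
  calc ‖Φ i x‖ = ‖Φ i (x - y) + Φ i y‖ := by rw [← map_add, sub_add_cancel]
    _ ≤ ‖Φ i (x - y)‖ + ‖Φ i y‖ := norm_add_le _ _
    _ ≤ ‖x - y‖ * (|C| + 1) + ‖Φ i y‖ := by
      gcongr
      nlinarith [hi (x - y), le_abs_self C, norm_nonneg (x - y)]
    _ < ε := by linarith

section YosidaSequence

variable {E : Type*} [NormedAddCommGroup E] [InnerProductSpace ℝ E]
  {Γ : Submodule ℝ (E × E)} {c : ℝ≥0} {lam : ℕ → ℝ} {J : ℕ → E →L[ℝ] E}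

/-- The operators `J n` are resolvents of `Γ` at points `lam n` tending to infinity, all of them so
large that the Yosida approximations `yosida (lam n) (J n)` generate semigroups of growth at most
`2 * c`. -/
structure IsYosidaSequence (Γ : Submodule ℝ (E × E)) (c : ℝ≥0) (lam : ℕ → ℝ) (J : ℕ → E →L[ℝ] E) :
    Prop where
  tendsto_atTop : Tendsto lam atTop atTop
  pos : ∀ n, 0 < lam n
  two_mul_le : ∀ n, 2 * c ≤ lam n
  isResolvent : ∀ n, IsResolvent Γ (lam n) (J n)

theorem IsQuasiContractionGenerator.exists_isYosidaSequence
    (h : IsQuasiContractionGenerator Γ c) : ∃ lam J, IsYosidaSequence Γ c lam J := by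
  obtain ⟨lam₀, hs⟩ := h.surj
  let lam (n : ℕ) : ℝ := |lam₀| + 2 * c + (n + 1)
  have hlam (n : ℕ) : |lam₀| + 2 * c < lam n := lt_add_of_pos_right _ (by positivity)
  have hJ (n : ℕ) : ∃ J, IsResolvent Γ (lam n) J :=
    h.exists_isResolvent_of_surj (by linarith [hlam n, abs_nonneg lam₀, c.coe_nonneg])
      (hs _ (by linarith [hlam n, le_abs_self lam₀, c.coe_nonneg]))
  choose J hJ using hJ
  exact ⟨lam, J, tendsto_atTop_add_const_left _ _
      (tendsto_atTop_add_const_right _ _ tendsto_natCast_atTop_atTop),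
    fun n => by positivity, fun n => by linarith [hlam n, abs_nonneg lam₀], hJ⟩

namespace IsYosidaSequence

theorem norm_smul_apply_le (h : IsQuasiContractionGenerator Γ c) (hJ : IsYosidaSequence Γ c lam J)
    (n : ℕ) (z : E) : ‖lam n • J n z‖ ≤ 2 * ‖z‖ :=
  h.norm_smul_apply_le (hJ.isResolvent n) (hJ.pos n) (hJ.two_mul_le n) z

theorem inner_yosida_le (h : IsQuasiContractionGenerator Γ c) (hJ : IsYosidaSequence Γ c lam J)
    (n : ℕ) (z : E) : inner ℝ (yosida (lam n) (J n) z) z ≤ 2 * c * ‖z‖ ^ 2 :=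
  h.inner_yosida_le (hJ.isResolvent n) (hJ.pos n) (hJ.two_mul_le n) z

variable [CompleteSpace E]

theorem tendsto_smul_apply (h : IsQuasiContractionGenerator Γ c) (hJ : IsYosidaSequence Γ c lam J)
    (z : E) : Tendsto (fun n => lam n • J n z) atTop (𝓝 z) := by
  refine tendsto_sub_nhds_zero_iff.1 (tendsto_apply_zero_of_dense (C := 3)
    (Φ := fun n => lam n • J n - 1) (Eventually.of_forall fun n w => ?_) h.dense_fst ?_ z)
  · calc ‖lam n • J n w - w‖ ≤ ‖lam n • J n w‖ + ‖w‖ := norm_sub_le _ _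
      _ ≤ 3 * ‖w‖ := by linarith [norm_smul_apply_le h hJ n w]
  · rintro _ ⟨p, hp, rfl⟩
    refine squeeze_zero_norm (a := fun n => (lam n)⁻¹ * (2 * ‖p.2‖)) (fun n => ?_) ?_
    · calc ‖lam n • J n p.1 - p.1‖ = (lam n)⁻¹ * ‖lam n • J n p.2‖ := by
            rw [(hJ.isResolvent n).smul_apply_sub hp, norm_smul_of_nonneg (hJ.pos n).le,
              inv_mul_cancel_left₀ (hJ.pos n).ne']
        _ ≤ (lam n)⁻¹ * (2 * ‖p.2‖) :=
          mul_le_mul_of_nonneg_left (norm_smul_apply_le h hJ n _) (inv_pos.2 (hJ.pos n)).le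
    · simpa only [zero_mul, Function.comp_apply] using
        (tendsto_inv_atTop_zero.comp hJ.tendsto_atTop).mul_const (2 * ‖p.2‖)

theorem tendsto_smul_apply_of_tendsto (h : IsQuasiContractionGenerator Γ c)
    (hJ : IsYosidaSequence Γ c lam J) {w : ℕ → E} {z : E} (hw : Tendsto w atTop (𝓝 z)) :
    Tendsto (fun n => lam n • J n (w n)) atTop (𝓝 z) := by
  have hsub : Tendsto (fun n => lam n • J n (w n - z)) atTop (𝓝 0) :=
    squeeze_zero_norm (fun n => norm_smul_apply_le h hJ n _) <| by
      simpa only [mul_zero] using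
        (tendsto_iff_norm_sub_tendsto_zero.1 hw).const_mul 2
  simpa only [map_sub, smul_sub, sub_add_cancel, zero_add] using
    hsub.add (tendsto_smul_apply h hJ z)

theorem tendsto_exp_sub_exp (h : IsQuasiContractionGenerator Γ c) (hJ : IsYosidaSequence Γ c lam J)
    (T : ℝ) (x : E) :
    Tendsto (fun q : (ℕ × ℕ) × ℝ => NormedSpace.exp (q.2 • yosida (lam q.1.1) (J q.1.1)) x -
      NormedSpace.exp (q.2 • yosida (lam q.1.2) (J q.1.2)) x)
      ((atTop ×ˢ atTop) ×ˢ 𝓟 (Icc 0 T)) (𝓝 0) := by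
  have hmem : ∀ᶠ q : (ℕ × ℕ) × ℝ in (atTop ×ˢ atTop) ×ˢ 𝓟 (Icc 0 T), q.2 ∈ Icc 0 T :=
    tendsto_snd.eventually (mem_principal_self _)
  have hexp {s : ℝ} (hs : s ∈ Icc 0 T) : Real.exp (2 * c * s) ≤ Real.exp (2 * c * T) :=
    Real.exp_le_exp.2 (mul_le_mul_of_nonneg_left hs.2 (by positivity))
  refine tendsto_apply_zero_of_dense (C := 2 * Real.exp (2 * c * T))
    (Φ := fun q : (ℕ × ℕ) × ℝ => NormedSpace.exp (q.2 • yosida (lam q.1.1) (J q.1.1)) -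
      NormedSpace.exp (q.2 • yosida (lam q.1.2) (J q.1.2))) ?_ h.dense_fst ?_ x
  · filter_upwards [hmem] with q hq y
    have hle (n : ℕ) : ‖NormedSpace.exp (q.2 • yosida (lam n) (J n)) y‖ ≤
        Real.exp (2 * c * T) * ‖y‖ :=
      (norm_exp_smul_apply_le (inner_yosida_le h hJ n) y hq.1).trans
        (mul_le_mul_of_nonneg_right (hexp hq) (norm_nonneg y))
    exact (norm_sub_le _ _).trans ((add_le_add (hle q.1.1) (hle q.1.2)).trans_eq (by ring))
  · rintro _ ⟨p, hp, rfl⟩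
    have hconv : Tendsto (fun n => yosida (lam n) (J n) p.1) atTop (𝓝 p.2) := by
      simpa only [(hJ.isResolvent _).yosida_fst hp] using tendsto_smul_apply h hJ p.2
    refine squeeze_zero_norm' (a := fun q : (ℕ × ℕ) × ℝ => Real.exp (2 * c * T) *
      ‖yosida (lam q.1.1) (J q.1.1) p.1 - yosida (lam q.1.2) (J q.1.2) p.1‖ * T) ?_ ?_
    · filter_upwards [hmem] with q hq
      refine (norm_exp_smul_sub_exp_smul_le (inner_yosida_le h hJ _) (inner_yosida_le h hJ _)
        ((hJ.isResolvent _).commute_yosida (hJ.isResolvent _)) p.1 hq.1).trans ?_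
      have : 0 ≤ T := hq.1.trans hq.2
      gcongr
      exacts [hq.1, hq.2, hq.2]
    · have hdiff := ((hconv.comp tendsto_fst).sub (hconv.comp tendsto_snd)).norm.comp
        (tendsto_fst (f := atTop ×ˢ atTop) (g := 𝓟 (Icc 0 T)))
      simpa [Function.comp_def] using (hdiff.const_mul (Real.exp (2 * c * T))).mul_const T

end IsYosidaSequence

end YosidaSequence

section MildSolution

variable {E : Type*} [NormedAddCommGroup E] [NormedSpace ℝ E] {Γ : Submodule ℝ (E × E)}

/-- `Y` is a mild solution, for times in `I`, of `Y' = A Y`, where `A` is the operator with graph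
`Γ`: the integral of `Y` from `0` to `t` lies in the domain and `A` maps it to `Y t - Y 0`. -/
def IsMildSolutionOn (Γ : Submodule ℝ (E × E)) (I : Set ℝ) (Y : ℝ → E) : Prop :=
  ∀ t ∈ I, (∫ s in (0 : ℝ)..t, Y s, Y t - Y 0) ∈ Γ

/-- The graph of `-A`, where `Γ` is the graph of `A`. -/
def reverse (Γ : Submodule ℝ (E × E)) : Submodule ℝ (E × E) :=
  Γ.comap (LinearMap.prodMap LinearMap.id (-LinearMap.id))

theorem mem_reverse {p : E × E} : p ∈ reverse Γ ↔ (p.1, -p.2) ∈ Γ := Iff.rfl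

theorem reverse_reverse (Γ : Submodule ℝ (E × E)) : reverse (reverse Γ) = Γ := by
  ext p
  rw [mem_reverse, mem_reverse, neg_neg]

namespace IsMildSolutionOn

variable {I I' : Set ℝ} {Y Z : ℝ → E}

theorem mono (hY : IsMildSolutionOn Γ I Y) (h : I' ⊆ I) : IsMildSolutionOn Γ I' Y :=
  fun t ht => hY t (h ht)

theorem sub (hY : IsMildSolutionOn Γ I Y) (hZ : IsMildSolutionOn Γ I Z) (hYc : Continuous Y)
    (hZc : Continuous Z) : IsMildSolutionOn Γ I fun t => Y t - Z t := fun t ht => by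
  have h := Γ.sub_mem (hY t ht) (hZ t ht)
  rwa [Prod.mk_sub_mk, sub_sub_sub_comm, ← intervalIntegral.integral_sub
    (hYc.intervalIntegrable _ _) (hZc.intervalIntegrable _ _)] at h

theorem congr (hY : IsMildSolutionOn Γ I Y) [I.OrdConnected] (h0 : 0 ∈ I) (h : EqOn Y Z I) :
    IsMildSolutionOn Γ I Z := fun t ht => by
  have hintegral : ∫ s in (0 : ℝ)..t, Y s = ∫ s in (0 : ℝ)..t, Z s :=
    intervalIntegral.integral_congr fun s hs => h (OrdConnected.uIcc_subset ‹_› h0 ht hs)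
  rw [← hintegral, ← h ht, ← h h0]
  exact hY t ht

theorem comp_neg (hY : IsMildSolutionOn Γ I Y) :
    IsMildSolutionOn (reverse Γ) (-I) fun t => Y (-t) := fun t ht => by
  have h := Γ.neg_mem (hY (-t) ht)
  rw [mem_reverse, intervalIntegral.integral_comp_neg, intervalIntegral.integral_symm]
  simpa only [neg_zero, Prod.neg_mk] using h

end IsMildSolutionOn

end MildSolution

section Semigroup

variable {E : Type*} [NormedAddCommGroup E] [InnerProductSpace ℝ E] [CompleteSpace E]
  {Γ : Submodule ℝ (E × E)} {c : ℝ≥0} {lam : ℕ → ℝ} {J : ℕ → E →L[ℝ] E}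

theorem IsYosidaSequence.smul_apply_integral_exp_mem (hJ : IsYosidaSequence Γ c lam J) (n : ℕ)
    (x : E) (t : ℝ) :
    (lam n • J n (∫ s in (0 : ℝ)..t, NormedSpace.exp (s • yosida (lam n) (J n)) x),
      NormedSpace.exp (t • yosida (lam n) (J n)) x - x) ∈ Γ := by
  have hcont := continuous_exp_smul_apply (yosida (lam n) (J n)) x
  have hintegral : NormedSpace.exp (t • yosida (lam n) (J n)) x - x = yosida (lam n) (J n)
      (∫ s in (0 : ℝ)..t, NormedSpace.exp (s • yosida (lam n) (J n)) x) := by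
    rw [← ContinuousLinearMap.intervalIntegral_comp_comm _ (hcont.intervalIntegrable _ _),
      intervalIntegral.integral_eq_sub_of_hasDerivAt
        (fun s _ => hasDerivAt_exp_smul_apply _ x s)
        (((yosida (lam n) (J n)).continuous.comp hcont).intervalIntegrable _ _),
      exp_zero_smul_apply]
  rw [hintegral]
  exact (hJ.isResolvent n).mk_smul_yosida_mem _

theorem IsYosidaSequence.exists_continuousOn_tendsto_exp (h : IsQuasiContractionGenerator Γ c)
    (hJ : IsYosidaSequence Γ c lam J) (x : E) :
    ∃ Y : ℝ → E, ContinuousOn Y (Ici 0) ∧ ∀ t, 0 ≤ t →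
      Tendsto (fun n => NormedSpace.exp (t • yosida (lam n) (J n)) x) atTop (𝓝 (Y t)) := by
  let F (n : ℕ) (t : ℝ) : E := NormedSpace.exp (t • yosida (lam n) (J n)) x
  have hcauchy (T : ℝ) : UniformCauchySeqOn F atTop (Icc 0 T) := by
    refine uniformCauchySeqOn_iff_uniformCauchySeqOnFilter.2 fun u hu => ?_
    obtain ⟨ε, hε, hu⟩ := Metric.mem_uniformity_dist.1 hu
    filter_upwards [Metric.tendsto_nhds.1 (hJ.tendsto_exp_sub_exp h T x) ε hε] with q hq
    exact hu (by rwa [dist_zero_right, ← dist_eq_norm] at hq)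
  choose! Y hY using fun t (ht : 0 ≤ t) =>
    cauchySeq_tendsto_of_complete ((hcauchy t).cauchySeq ⟨ht, le_rfl⟩)
  refine ⟨Y, fun t ht => ?_, hY⟩
  have hunif : TendstoUniformlyOn F Y atTop (Icc 0 (t + 1)) :=
    (hcauchy (t + 1)).tendstoUniformlyOn_of_tendsto fun s hs => hY s hs.1
  have hcont : ContinuousOn Y (Icc 0 (t + 1)) := hunif.continuousOn
    (Frequently.of_forall fun n => (continuous_exp_smul_apply _ x).continuousOn)
  refine (hcont t ⟨ht, by linarith⟩).mono_of_mem_nhdsWithin ?_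
  exact mem_of_superset (inter_mem_nhdsWithin _ (Iic_mem_nhds (lt_add_one t))) subset_rfl

theorem IsQuasiContractionGenerator.exists_isMildSolutionOn (h : IsQuasiContractionGenerator Γ c)
    (x : E) : ∃ Y : ℝ → E, Continuous Y ∧ Y 0 = x ∧ IsMildSolutionOn Γ (Ici 0) Y ∧
      ∀ t, 0 ≤ t → ‖Y t‖ ≤ Real.exp (2 * c * t) * ‖x‖ := by
  obtain ⟨lam, J, hJ⟩ := h.exists_isYosidaSequence
  obtain ⟨Y, hYc, hY⟩ := hJ.exists_continuousOn_tendsto_exp h x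
  let F (n : ℕ) (t : ℝ) : E := NormedSpace.exp (t • yosida (lam n) (J n)) x
  have hF (n : ℕ) {t : ℝ} (ht : 0 ≤ t) : ‖F n t‖ ≤ Real.exp (2 * c * t) * ‖x‖ :=
    norm_exp_smul_apply_le (hJ.inner_yosida_le h n) x ht
  have hY0 : Y 0 = x := tendsto_nhds_unique (hY 0 le_rfl) (by simp)
  have hmild : IsMildSolutionOn Γ (Ici 0) Y := fun t ht => by
    have hintegral : Tendsto (fun n => ∫ s in (0 : ℝ)..t, F n s) atTop
        (𝓝 (∫ s in (0 : ℝ)..t, Y s)) := by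
      refine intervalIntegral.tendsto_integral_filter_of_dominated_convergence
        (fun s => Real.exp (2 * c * s) * ‖x‖)
        (Eventually.of_forall fun n => (continuous_exp_smul_apply _ x).aestronglyMeasurable)
        (Eventually.of_forall fun n => Eventually.of_forall fun s hs => hF n ?_)
        (Continuous.intervalIntegrable (by fun_prop) _ _)
        (Eventually.of_forall fun s hs => hY s ?_)
      all_goals exact ((uIoc_of_le (mem_Ici.1 ht)).subset hs).1.le
    refine (hJ.isResolvent 0).isClosed.mem_of_tendsto
      ((hJ.tendsto_smul_apply_of_tendsto h hintegral).prodMk_nhds ((hY t ht).sub_const _))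
      (Eventually.of_forall fun n => ?_)
    rw [hY0]
    exact hJ.smul_apply_integral_exp_mem n x t
  have hproj : EqOn Y (fun t => Y (max t 0)) (Ici 0) := fun t ht => by
    simp only [max_eq_left (mem_Ici.1 ht)]
  refine ⟨fun t => Y (max t 0), hYc.comp_continuous (by fun_prop) fun t => le_max_right t 0,
    by simp only [max_self, hY0], hmild.congr self_mem_Ici hproj, fun t ht => ?_⟩
  rw [← hproj ht]
  exact le_of_tendsto (hY t ht).norm (Eventually.of_forall fun n => hF n ht)

theorem IsQuasiContractionGenerator.eq_zero_of_isMildSolutionOn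
    (h : IsQuasiContractionGenerator Γ c) {Y : ℝ → E} (hYc : Continuous Y) (hY0 : Y 0 = 0)
    (hY : IsMildSolutionOn Γ (Ici 0) Y) {t : ℝ} (ht : 0 ≤ t) : Y t = 0 := by
  let Z (t : ℝ) : E := ∫ s in (0 : ℝ)..t, Y s
  have hZ (t : ℝ) : HasDerivAt Z (Y t) t := (hYc.integral_hasStrictDerivAt 0 t).hasDerivAt
  have hmem {t : ℝ} (ht : 0 ≤ t) : (Z t, Y t) ∈ Γ := by
    simpa only [hY0, sub_zero] using hY t ht
  have hZt : Z t = 0 := by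
    have hle := norm_le_exp_mul_of_inner_deriv_le hZ (fun s hs => h.inner_le _ (hmem hs)) ht
    simpa only [Z, intervalIntegral.integral_same, norm_zero, mul_zero, norm_le_zero_iff] using hle
  exact h.eq_zero _ (hZt ▸ hmem ht)

end Semigroup

section Group

variable {E : Type*} [NormedAddCommGroup E] [InnerProductSpace ℝ E]
  {Γ : Submodule ℝ (E × E)} {c : ℝ≥0}

/-- Both `Γ` and its reversal generate quasi-contraction semigroups, so that `Γ` generates a
group. -/
structure IsGroupGenerator (Γ : Submodule ℝ (E × E)) (c : ℝ≥0) : Prop where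
  forward : IsQuasiContractionGenerator Γ c
  backward : IsQuasiContractionGenerator (reverse Γ) c

theorem isGroupGenerator_of_abs_inner_le (hle : ∀ p ∈ Γ, |inner ℝ p.2 p.1| ≤ c * ‖p.1‖ ^ 2)
    (hsurj : ∃ lam₀ : ℝ, ∀ lam : ℝ, lam₀ < |lam| → ∀ z, ∃ p ∈ Γ, lam • p.1 - p.2 = z)
    (hzero : ∀ y, ((0 : E), y) ∈ Γ → y = 0) : IsGroupGenerator Γ c := by
  obtain ⟨lam₀, hs⟩ := hsurj
  refine ⟨⟨fun p hp => (le_abs_self _).trans (hle p hp),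
    ⟨lam₀, fun lam hlam => hs lam (hlam.trans_le (le_abs_self lam))⟩, hzero⟩,
    ⟨fun p hp => ?_, ⟨lam₀, fun lam hlam z => ?_⟩, fun y hy => neg_eq_zero.1 (hzero _ hy)⟩⟩
  · have h := hle _ (mem_reverse.1 hp)
    rw [inner_neg_left, abs_neg] at h
    exact (le_abs_self _).trans h
  · obtain ⟨p, hp, hpz⟩ := hs (-lam) (by rw [abs_neg]; exact hlam.trans_le (le_abs_self lam)) (-z)
    refine ⟨(p.1, -p.2), by rwa [mem_reverse, neg_neg], ?_⟩
    linear_combination (norm := module) -hpz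

namespace IsGroupGenerator

variable [CompleteSpace E]

theorem exists_isMildSolutionOn_univ (h : IsGroupGenerator Γ c) (x : E) :
    ∃ Y : ℝ → E, Continuous Y ∧ Y 0 = x ∧ IsMildSolutionOn Γ univ Y ∧
      ∀ t, ‖Y t‖ ≤ Real.exp (2 * c * |t|) * ‖x‖ := by
  obtain ⟨S, hSc, hS0, hS, hSle⟩ := h.forward.exists_isMildSolutionOn x
  obtain ⟨S', hSc', hS0', hS', hSle'⟩ := h.backward.exists_isMildSolutionOn x
  let Y (t : ℝ) : E := if 0 ≤ t then S t else S' (-t)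
  have hpos : EqOn S Y (Ici 0) := fun t ht => (if_pos (mem_Ici.1 ht)).symm
  have hneg : EqOn (fun t => S' (-t)) Y (Iic 0) := fun t ht => by
    rcases (mem_Iic.1 ht).eq_or_lt with rfl | hlt
    · simp only [Y, neg_zero, le_refl, if_true, hS0, hS0']
    · simp only [Y, hlt.not_ge, if_false]
  have hback : IsMildSolutionOn Γ (Iic 0) fun t => S' (-t) := by
    simpa only [reverse_reverse, neg_Ici, neg_zero] using hS'.comp_neg
  refine ⟨Y, hSc.if_le (hSc'.comp continuous_neg) continuous_const continuous_id ?_,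
    (hpos self_mem_Ici).symm.trans hS0, fun t _ => ?_, fun t => ?_⟩
  · rintro t rfl
    exact hS0.trans (hS0'.symm.trans (congrArg S' neg_zero.symm))
  · rcases le_total 0 t with ht | ht
    · exact hS.congr self_mem_Ici hpos t ht
    · exact hback.congr self_mem_Iic hneg t ht
  · rcases le_total 0 t with ht | ht
    · rw [← hpos ht, abs_of_nonneg ht]
      exact hSle t ht
    · rw [← hneg ht, abs_of_nonpos ht]
      exact hSle' (-t) (neg_nonneg.2 ht)

variable {Y Z : ℝ → E}

theorem eq_of_isMildSolutionOn_univ (h : IsGroupGenerator Γ c) (hYc : Continuous Y)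
    (hZc : Continuous Z) (hY : IsMildSolutionOn Γ univ Y) (hZ : IsMildSolutionOn Γ univ Z)
    (h0 : Y 0 = Z 0) : Y = Z := by
  have hD := hY.sub hZ hYc hZc
  have hDc : Continuous fun t => Y t - Z t := hYc.sub hZc
  funext t
  rcases le_total 0 t with ht | ht
  · exact sub_eq_zero.1 (h.forward.eq_zero_of_isMildSolutionOn hDc (sub_eq_zero.2 h0)
      (hD.mono (subset_univ _)) ht)
  · have hback := h.backward.eq_zero_of_isMildSolutionOn (hDc.comp continuous_neg)
      (by simpa only [Function.comp_apply, neg_zero] using sub_eq_zero.2 h0)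
      (hD.comp_neg.mono (by simp only [Set.neg_univ, subset_univ])) (neg_nonneg.2 ht)
    simpa only [Function.comp_apply, neg_neg, sub_eq_zero] using hback

theorem existsUnique_isMildSolutionOn_univ (h : IsGroupGenerator Γ c) (x : E) :
    ∃! Y : C(ℝ, E), Y 0 = x ∧ IsMildSolutionOn Γ univ Y := by
  obtain ⟨Y, hYc, hY0, hY, -⟩ := h.exists_isMildSolutionOn_univ x
  exact ⟨⟨Y, hYc⟩, ⟨hY0, hY⟩, fun Z ⟨hZ0, hZ⟩ => DFunLike.coe_injective
    (h.eq_of_isMildSolutionOn_univ Z.continuous hYc hZ hY (hZ0.trans hY0.symm))⟩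

theorem norm_le_of_isMildSolutionOn_univ (h : IsGroupGenerator Γ c) (hYc : Continuous Y)
    (hY : IsMildSolutionOn Γ univ Y) (t : ℝ) : ‖Y t‖ ≤ Real.exp (2 * c * |t|) * ‖Y 0‖ := by
  obtain ⟨Z, hZc, hZ0, hZ, hZle⟩ := h.exists_isMildSolutionOn_univ (Y 0)
  rw [h.eq_of_isMildSolutionOn_univ hYc hZc hY hZ hZ0.symm, hZ0]
  exact hZle t

theorem continuous_of_isMildSolutionOn_univ (h : IsGroupGenerator Γ c) {W : ℝ → E → E}
    (hWc : ∀ x, Continuous fun t => W t x) (hW : ∀ x, IsMildSolutionOn Γ univ fun t => W t x)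
    (hW0 : ∀ x, W 0 x = x) (t : ℝ) : Continuous (W t) := by
  refine (LipschitzWith.of_dist_le' (K := Real.exp (2 * c * |t|)) fun x y => ?_).continuous
  have hle := h.norm_le_of_isMildSolutionOn_univ ((hWc x).sub (hWc y))
    ((hW x).sub (hW y) (hWc x) (hWc y)) t
  simpa only [Pi.sub_apply, hW0, ← dist_eq_norm] using hle

end IsGroupGenerator

end Group

section Perturbation

variable {E : Type*} [NormedAddCommGroup E] [NormedSpace ℝ E]
  {Γ : Submodule ℝ (E × E)} {B : E →L[ℝ] E}

/-- The graph of `A + B`, where `Γ` is the graph of `A`. -/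
def perturb (Γ : Submodule ℝ (E × E)) (B : E →L[ℝ] E) : Submodule ℝ (E × E) :=
  Γ.comap ((LinearMap.fst ℝ E E).prod (LinearMap.snd ℝ E E - B.toLinearMap ∘ₗ LinearMap.fst ℝ E E))

theorem mem_perturb {p : E × E} : p ∈ perturb Γ B ↔ (p.1, p.2 - B p.1) ∈ Γ := Iff.rfl

theorem reverse_perturb (Γ : Submodule ℝ (E × E)) (B : E →L[ℝ] E) :
    reverse (perturb Γ B) = perturb (reverse Γ) (-B) := by
  ext p
  rw [mem_reverse, mem_perturb, mem_perturb, mem_reverse, neg_apply, sub_neg_eq_add, neg_add']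

end Perturbation

section PerturbedGenerator

variable {E : Type*} [NormedAddCommGroup E] [InnerProductSpace ℝ E] [CompleteSpace E]
  {Γ : Submodule ℝ (E × E)} {c : ℝ≥0} {B : E →L[ℝ] E}

theorem IsQuasiContractionGenerator.exists_mem_perturb (h : IsQuasiContractionGenerator Γ c)
    {lam : ℝ} (hlam : c + ‖B‖ < lam) (hsurj : ∀ z, ∃ p ∈ Γ, lam • p.1 - p.2 = z) (z : E) :
    ∃ p ∈ perturb Γ B, lam • p.1 - p.2 = z := by
  have hpos : 0 < lam - c := by linarith [norm_nonneg B]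
  obtain ⟨J, hJ⟩ := h.exists_isResolvent_of_surj (sub_pos.1 hpos) hsurj
  have hJle : ‖J‖ ≤ (lam - c)⁻¹ :=
    J.opNorm_le_bound (inv_nonneg.2 hpos.le) fun w => (le_inv_mul_iff₀ hpos).2 <| by
      simpa only [sub_sub_cancel] using h.sub_mul_norm_le lam (hJ.mk_mem w)
  have hBJ : ‖B * J‖ < 1 :=
    calc ‖B * J‖ ≤ ‖B‖ * (lam - c)⁻¹ :=
          (norm_mul_le _ _).trans (mul_le_mul_of_nonneg_left hJle (norm_nonneg _))
      _ < 1 := by rw [← div_eq_mul_inv, div_lt_one hpos]; linarith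
  let u : (E →L[ℝ] E)ˣ := Units.oneSub (B * J) hBJ
  let w : E := u⁻¹.val z
  have hw : w - B (J w) = z := congrArg (fun C : E →L[ℝ] E => C z) u.mul_inv
  refine ⟨(J w, lam • J w - w + B (J w)), ?_, ?_⟩
  · rw [mem_perturb, add_sub_cancel_right]
    exact hJ.mk_mem w
  · rw [← hw]
    module

theorem IsQuasiContractionGenerator.perturb (h : IsQuasiContractionGenerator Γ c)
    (B : E →L[ℝ] E) : IsQuasiContractionGenerator (perturb Γ B) (c + ‖B‖₊) where
  inner_le p hp := by
    have hΓ := h.inner_le _ (mem_perturb.1 hp)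
    rw [inner_sub_left] at hΓ
    have hB : inner ℝ (B p.1) p.1 ≤ ‖B‖ * ‖p.1‖ * ‖p.1‖ :=
      (real_inner_le_norm _ _).trans
        (mul_le_mul_of_nonneg_right (B.le_opNorm p.1) (norm_nonneg _))
    rw [NNReal.coe_add, coe_nnnorm]
    linarith
  surj := by
    obtain ⟨lam₀, hs⟩ := h.surj
    exact ⟨max lam₀ (c + ‖B‖), fun lam hlam => h.exists_mem_perturb
      ((le_max_right _ _).trans_lt hlam) (hs lam ((le_max_left _ _).trans_lt hlam))⟩
  eq_zero y hy := h.eq_zero y (by simpa only [mem_perturb, map_zero, sub_zero] using hy)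

theorem IsGroupGenerator.perturb (h : IsGroupGenerator Γ c) (B : E →L[ℝ] E) :
    IsGroupGenerator (perturb Γ B) (c + ‖B‖₊) where
  forward := h.forward.perturb B
  backward := by
    rw [reverse_perturb, ← nnnorm_neg]
    exact h.backward.perturb (-B)

end PerturbedGenerator

section WeakGraph

variable {E : Type*} [NormedAddCommGroup E] [NormedSpace ℝ E]

/-- The relation `{(x, y) | l y = l' x for all (l, l') ∈ L}` cut out by the weak equations `L`. -/
def weakGraph (L : Set ((E →L[ℝ] ℝ) × (E →L[ℝ] ℝ))) : Submodule ℝ (E × E) :=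
  ⨅ l ∈ L, LinearMap.ker (l.1.toLinearMap ∘ₗ LinearMap.snd ℝ E E -
    l.2.toLinearMap ∘ₗ LinearMap.fst ℝ E E)

variable {L : Set ((E →L[ℝ] ℝ) × (E →L[ℝ] ℝ))}

theorem mem_weakGraph {p : E × E} : p ∈ weakGraph L ↔ ∀ l ∈ L, l.1 p.2 = l.2 p.1 := by
  simp only [weakGraph, Submodule.mem_iInf, LinearMap.mem_ker, LinearMap.sub_apply,
    LinearMap.comp_apply, LinearMap.fst_apply, LinearMap.snd_apply,
    ContinuousLinearMap.coe_coe, sub_eq_zero]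

variable [CompleteSpace E] {Y : ℝ → E}

theorem forall_hasDerivAt_iff_forall_integral_eq (hY : Continuous Y) (l l' : E →L[ℝ] ℝ) :
    (∀ t, HasDerivAt (fun s => l (Y s)) (l' (Y t)) t) ↔
      ∀ t, l (Y t - Y 0) = l' (∫ s in (0 : ℝ)..t, Y s) := by
  have hl' : Continuous fun s => l' (Y s) := l'.continuous.comp hY
  have hintegral (t : ℝ) : l' (∫ s in (0 : ℝ)..t, Y s) = ∫ s in (0 : ℝ)..t, l' (Y s) :=
    (l'.intervalIntegral_comp_comm (hY.intervalIntegrable 0 t)).symm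
  simp only [hintegral, map_sub]
  refine ⟨fun h t => (intervalIntegral.integral_eq_sub_of_hasDerivAt (fun s _ => h s)
    (hl'.intervalIntegrable _ _)).symm, fun h t => ?_⟩
  refine ((hl'.integral_hasStrictDerivAt 0 t).hasDerivAt.const_add (l (Y 0))).congr_of_eventuallyEq
    (Eventually.of_forall fun s => ?_)
  simp only [← h s, add_sub_cancel]

theorem isMildSolutionOn_perturb_weakGraph_iff (hY : Continuous Y) (B : E →L[ℝ] E) :
    IsMildSolutionOn (perturb (weakGraph L) B) univ Y ↔
      ∀ l ∈ L, ∀ t, HasDerivAt (fun s => l.1 (Y s)) (l.2 (Y t) + l.1 (B (Y t))) t := by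
  have hl (l : (E →L[ℝ] ℝ) × (E →L[ℝ] ℝ)) :=
    forall_hasDerivAt_iff_forall_integral_eq hY l.1 (l.2 + l.1 ∘L B)
  simp only [add_apply, ContinuousLinearMap.comp_apply] at hl
  simp only [hl, IsMildSolutionOn, mem_univ, true_imp_iff, mem_perturb, mem_weakGraph, map_sub,
    sub_eq_iff_eq_add]
  exact ⟨fun h l hl t => h t l hl, fun h t l hl => h l hl t⟩

end WeakGraph

/-! ### Weighted Sobolev spaces -/

section Duality

variable {d : ℕ} {α : ℝ}
variable {G : Type*} [NormedAddCommGroup G] [NormedSpace ℝ G]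
variable {F : Type*} [NormedAddCommGroup F] [InnerProductSpace ℝ F]

theorem contDiff_weight (α : ℝ) : ContDiff ℝ ∞ (weight (d := d) α) :=
  ContDiff.rpow_const_of_ne (contDiff_const.add (contDiff_norm_sq ℝ)) fun x => by positivity

theorem weight_neg_mul_weight (α : ℝ) (x : Space d) : weight (-α) x * weight α x = 1 := by
  rw [weight, weight, ← Real.rpow_add (by positivity), neg_add_cancel, Real.rpow_zero]

theorem measurable_ofReal_weight (α : ℝ) :
    Measurable fun x : Space d => ENNReal.ofReal (weight α x) :=
  (continuous_weight α).measurable.ennreal_ofReal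

theorem volume_absolutelyContinuous_fieldMeasure :
    (volume : Measure (Space d)) ≪ fieldMeasure d α :=
  withDensity_absolutelyContinuous' (measurable_ofReal_weight α).aemeasurable
    (ae_of_all _ fun x => by simpa using weight_pos α x)

theorem ae_fieldMeasure_iff {p : Space d → Prop} :
    (∀ᵐ x ∂fieldMeasure d α, p x) ↔ ∀ᵐ x, p x :=
  ⟨fieldMeasure_ae, fun h => (withDensity_absolutelyContinuous _ _).ae_le h⟩

theorem aestronglyMeasurable_fieldMeasure_iff {E : Type*} [TopologicalSpace E]
    {f : Space d → E} :
    AEStronglyMeasurable f (fieldMeasure d α) ↔ AEStronglyMeasurable f :=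
  ⟨fun h => h.mono_ac volume_absolutelyContinuous_fieldMeasure,
    fun h => h.mono_ac (withDensity_absolutelyContinuous _ _)⟩

theorem integral_fieldMeasure (f : Space d → G) :
    ∫ x, f x ∂fieldMeasure d α = ∫ x, weight α x • f x := by
  rw [fieldMeasure, integral_withDensity_eq_integral_toReal_smul (measurable_ofReal_weight α)
    (ae_of_all _ fun x => ENNReal.ofReal_lt_top)]
  simp only [ENNReal.toReal_ofReal (weight_pos α _).le]

theorem integrable_fieldMeasure_iff {f : Space d → G} :
    Integrable f (fieldMeasure d α) ↔ Integrable fun x => weight α x • f x := by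
  rw [fieldMeasure, integrable_withDensity_iff_integrable_smul' (measurable_ofReal_weight α)
    (ae_of_all _ fun x => ENNReal.ofReal_lt_top)]
  simp only [ENNReal.toReal_ofReal (weight_pos α _).le]

theorem memLp_two_fieldMeasure_iff {E : Type*} [NormedAddCommGroup E] {f : Space d → E}
    (hf : AEStronglyMeasurable f) :
    MemLp f 2 (fieldMeasure d α) ↔ Integrable fun x => weight α x * ‖f x‖ ^ 2 := by
  rw [memLp_two_iff_integrable_sq_norm (aestronglyMeasurable_fieldMeasure_iff.2 hf),
    integrable_fieldMeasure_iff]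
  simp only [smul_eq_mul]

theorem memLp_weight_neg_smul {φ : Space d → G} (hφ : MemLp φ 2 (fieldMeasure d (-α))) :
    MemLp (fun x => weight (-α) x • φ x) 2 (fieldMeasure d α) := by
  have hm := aestronglyMeasurable_fieldMeasure_iff.1 hφ.1
  rw [memLp_two_fieldMeasure_iff ((continuous_weight _).aestronglyMeasurable.fun_smul hm)]
  refine ((memLp_two_fieldMeasure_iff hm).1 hφ).congr (ae_of_all _ fun x => ?_)
  simp only [norm_smul, Real.norm_of_nonneg (weight_pos (-α) x).le]
  linear_combination (-weight (-α) x * ‖φ x‖ ^ 2) * weight_neg_mul_weight α x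

/-- The functional `f ↦ ∫ ⟨φ, f⟩ dx` on `L²((1 + |x|²)^α dx)` given by an element `φ` of
`L²((1 + |x|²)^(-α) dx)`. -/
def dualPairing {φ : Space d → F} (hφ : MemLp φ 2 (fieldMeasure d (-α))) :
    Lp F 2 (fieldMeasure d α) →L[ℝ] ℝ :=
  innerSL ℝ (memLp_weight_neg_smul hφ).toLp

theorem dualPairing_apply {φ : Space d → F} (hφ : MemLp φ 2 (fieldMeasure d (-α)))
    (f : Lp F 2 (fieldMeasure d α)) : dualPairing hφ f = ∫ x, inner ℝ (φ x) (f x) := by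
  rw [dualPairing, innerSL_apply_apply, L2.inner_def, integral_fieldMeasure]
  refine integral_congr_ae ?_
  filter_upwards [fieldMeasure_ae (memLp_weight_neg_smul hφ).coeFn_toLp] with x hx
  rw [hx, real_inner_smul_left, smul_eq_mul, ← mul_assoc, mul_comm (weight α x),
    weight_neg_mul_weight, one_mul]

theorem integrable_bilin_of_memLp {G' G'' : Type*} [NormedAddCommGroup G'] [NormedSpace ℝ G']
    [NormedAddCommGroup G''] [NormedSpace ℝ G''] (L : G →L[ℝ] G' →L[ℝ] G'') {φ : Space d → G}
    {f : Space d → G'} (hφ : MemLp φ 2 (fieldMeasure d (-α)))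
    (hf : MemLp f 2 (fieldMeasure d α)) : Integrable fun x => L (φ x) (f x) := by
  have h := memLp_one_iff_integrable.1 (L.memLp_of_bilin 1 (memLp_weight_neg_smul hφ) hf)
  refine (integrable_fieldMeasure_iff.1 h).congr (ae_of_all _ fun x => ?_)
  simp only [map_smul, smul_apply, smul_smul]
  rw [mul_comm, weight_neg_mul_weight, one_smul]

theorem locallyIntegrable_of_memLp_fieldMeasure {f : Space d → G}
    (hf : MemLp f 2 (fieldMeasure d α)) : LocallyIntegrable f := by
  rw [locallyIntegrable_iff]
  intro K hK
  obtain ⟨η, hη, -, hηc, -⟩ := exists_continuous_one_zero_of_isCompact hK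
    isClosed_empty (disjoint_empty K)
  have hintegrable : Integrable fun x => η x • f x :=
    (integrable_norm_iff (η.continuous.aestronglyMeasurable.fun_smul
      (aestronglyMeasurable_fieldMeasure_iff.1 hf.1))).1 <| by
      refine (integrable_mul_of_compact hf.norm η.continuous.norm hηc.norm).congr
        (ae_of_all _ fun x => ?_)
      simp only [norm_smul, mul_comm]
  refine (hintegrable.integrableOn (s := K)).congr_fun (fun x hx => ?_) hK.measurableSet
  simp [hη hx]

theorem eq_zero_of_forall_integral_smul_eq_zero [CompleteSpace G] {f : Lp G 2 (fieldMeasure d α)}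
    (h : ∀ φ : Space d → ℝ, IsTest φ → ∫ x, φ x • f x = 0) : f = 0 :=
  (Lp.eq_zero_iff_ae_eq_zero).2 <| ae_fieldMeasure_iff.2 <|
    ae_eq_zero_of_integral_contDiff_smul_eq_zero
      (locallyIntegrable_of_memLp_fieldMeasure (Lp.memLp f)) fun φ hφ hc => h φ ⟨hφ, hc⟩

end Duality

section TestFunctions

variable {d : ℕ} {α : ℝ} {φ : Space d → ℝ}

theorem sum_apply_smul_basisVec (v : Space d) : ∑ j, v j • basisVec j = v := by
  simpa [basisVec] using (EuclideanSpace.basisFun (Fin d) ℝ).sum_repr v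

theorem inner_gradient (φ : Space d → ℝ) (x v : Space d) : inner ℝ (∇ φ x) v = fderiv ℝ φ x v :=
  InnerProductSpace.toDual_symm_apply

theorem gradient_apply (φ : Space d → ℝ) (x : Space d) (j : Fin d) :
    ∇ φ x j = fderiv ℝ φ x (basisVec j) := by
  rw [← inner_gradient, basisVec, EuclideanSpace.inner_single_right, one_mul, conj_trivial]

theorem IsTest.fderiv_apply (hφ : IsTest φ) (v : Space d) : IsTest fun x => fderiv ℝ φ x v :=
  ⟨(hφ.1.fderiv_right (m := ∞) (by simp)).clm_apply contDiff_const, hφ.2.fderiv_apply ℝ v⟩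

theorem IsTest.mul_left {χ : Space d → ℝ} (hχ : IsTest χ) (hφ : ContDiff ℝ ∞ φ) :
    IsTest fun x => χ x * φ x :=
  ⟨hχ.1.mul hφ, hχ.2.mul_right⟩

theorem IsTest.memLp (hφ : IsTest φ) : MemLp φ 2 (fieldMeasure d α) :=
  hφ.1.continuous.memLp_of_hasCompactSupport hφ.2

theorem IsTest.memLp_smul (hφ : IsTest φ) (v : Space d) :
    MemLp (fun x => φ x • v) 2 (fieldMeasure d α) :=
  (hφ.1.continuous.smul continuous_const).memLp_of_hasCompactSupport hφ.2.smul_right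

theorem IsTest.memLp_gradient (hφ : IsTest φ) : MemLp (∇ φ) 2 (fieldMeasure d α) := by
  have hc : Continuous (fderiv ℝ φ) := hφ.1.continuous_fderiv (by simp)
  exact ((InnerProductSpace.toDual ℝ (Space d)).symm.continuous.comp hc).memLp_of_hasCompactSupport
    ((hφ.2.fderiv ℝ).comp_left (map_zero _))

/-- The functional `f ↦ ∫ f φ` on `H^{0,α}`, for a test function `φ`. -/
def IsTest.pairing (hφ : IsTest φ) : H0 d α →L[ℝ] ℝ := dualPairing hφ.memLp

theorem IsTest.pairing_apply (hφ : IsTest φ) (f : H0 d α) : hφ.pairing f = ∫ x, f x * φ x :=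
  dualPairing_apply _ _

theorem H0.eq_zero_of_forall_pairing_eq_zero {f : H0 d α}
    (h : ∀ φ, ∀ hφ : IsTest φ, hφ.pairing f = 0) : f = 0 :=
  eq_zero_of_forall_integral_smul_eq_zero fun φ hφ => by
    simpa only [hφ.pairing_apply, smul_eq_mul, mul_comm] using h φ hφ

/-- The functional `g ↦ ∫ g · ∇φ` on vector fields, for a test function `φ`. -/
def IsTest.gradPairing (hφ : IsTest φ) : H0Vec d α →L[ℝ] ℝ := dualPairing hφ.memLp_gradient

theorem IsTest.gradPairing_apply (hφ : IsTest φ) (g : H0Vec d α) :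
    hφ.gradPairing g = ∫ x, fderiv ℝ φ x (g x) := by
  rw [IsTest.gradPairing, dualPairing_apply]
  simp only [inner_gradient]

/-- The functional `g ↦ ∫ g_j φ` on vector fields, for a test function `φ`. -/
def IsTest.coordPairing (hφ : IsTest φ) (j : Fin d) : H0Vec d α →L[ℝ] ℝ :=
  dualPairing (hφ.memLp_smul (basisVec j))

theorem IsTest.coordPairing_apply (hφ : IsTest φ) (j : Fin d) (g : H0Vec d α) :
    hφ.coordPairing j g = ∫ x, g x j * φ x := by
  rw [IsTest.coordPairing, dualPairing_apply]
  simp only [real_inner_smul_left, basisVec, EuclideanSpace.inner_single_left, map_one, one_mul,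
    mul_comm]

theorem H0Vec.eq_zero_of_forall_coordPairing_eq_zero {g : H0Vec d α}
    (h : ∀ φ, ∀ hφ : IsTest φ, ∀ j, hφ.coordPairing j g = 0) : g = 0 := by
  refine eq_zero_of_forall_integral_smul_eq_zero fun φ hφ => ?_
  have hintegrable : Integrable fun x => φ x • g x :=
    (locallyIntegrable_of_memLp_fieldMeasure (Lp.memLp g)).integrable_smul_left_of_hasCompactSupport
      hφ.1.continuous hφ.2
  ext j
  have hj := (EuclideanSpace.proj (𝕜 := ℝ) j : Space d →L[ℝ] ℝ).integral_comp_comm hintegrable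
  simp only [PiLp.proj_apply] at hj
  rw [← hj, PiLp.zero_apply, ← h φ hφ j, hφ.coordPairing_apply]
  simp only [PiLp.smul_apply, smul_eq_mul, mul_comm]

end TestFunctions

section Sobolev

variable {d : ℕ} {α : ℝ}

/-- The vector field `G` has divergence `h` in the sense of distributions. -/
def IsWeakDivergence (G : Space d → Space d) (h : Space d → ℝ) : Prop :=
  ∀ φ : Space d → ℝ, IsTest φ → ∫ x, fderiv ℝ φ x (G x) = -∫ x, h x * φ x

theorem isWeakGradient_iff_isWeakDivergence {ψ : Space d → ℝ} {g : Space d → Space d} :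
    IsWeakGradient ψ g ↔
      ∀ j, IsWeakDivergence (fun x => ψ x • basisVec j) fun x => g x j := by
  simp only [IsWeakGradient, IsWeakDivergence, map_smul, smul_eq_mul]
  exact ⟨fun h j φ hφ => h φ hφ j, fun h φ hφ j => h j φ hφ⟩

theorem isWeakDivergence_iff {g : H0Vec d α} {h : H0 d α} :
    IsWeakDivergence g h ↔
      ∀ φ, ∀ hφ : IsTest φ, hφ.gradPairing g = -hφ.pairing h := by
  simp only [IsWeakDivergence, IsTest.gradPairing_apply, IsTest.pairing_apply]

theorem mem_H1_iff {p : WithLp 2 (H0 d α × H0Vec d α)} :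
    p ∈ H1 d α ↔ ∀ φ, ∀ hφ : IsTest φ, ∀ j,
      (hφ.fderiv_apply (basisVec j)).pairing p.fst = -hφ.coordPairing j p.snd := by
  simp only [IsTest.pairing_apply, IsTest.coordPairing_apply]
  rfl

theorem isClosed_H1 : IsClosed (H1 d α : Set (WithLp 2 (H0 d α × H0Vec d α))) := by
  simp only [← SetLike.setOfPred_mem_eq, mem_H1_iff, ofPred_forall]
  refine isClosed_iInter fun φ => isClosed_iInter fun hφ => isClosed_iInter fun j => ?_
  have hfst := (WithLp.fstL 2 ℝ (H0 d α) (H0Vec d α)).continuous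
  have hsnd := (WithLp.sndL 2 ℝ (H0 d α) (H0Vec d α)).continuous
  exact isClosed_eq ((ContinuousLinearMap.continuous _).comp hfst)
    ((ContinuousLinearMap.continuous _).comp hsnd).neg

instance : CompleteSpace (H1 d α) := isClosed_H1.completeSpace_coe

/-- The inclusion `H^{1,α} → H^{0,α}`. -/
def H1.value : H1 d α →L[ℝ] H0 d α := (WithLp.fstL 2 ℝ _ _).comp (H1 d α).subtypeL

/-- The gradient as a bounded operator on `H^{1,α}`. -/
def H1.grad : H1 d α →L[ℝ] H0Vec d α := (WithLp.sndL 2 ℝ _ _).comp (H1 d α).subtypeL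

theorem H1.isWeakGradient (ψ : H1 d α) : IsWeakGradient (H1.value ψ) (H1.grad ψ) := ψ.2

theorem H1.inner_eq (ψ χ : H1 d α) :
    inner ℝ ψ χ = inner ℝ (H1.value ψ) (H1.value χ) + inner ℝ (H1.grad ψ) (H1.grad χ) :=
  WithLp.prod_inner_apply (ψ : WithLp 2 (H0 d α × H0Vec d α)) χ

theorem H1.norm_sq_eq (ψ : H1 d α) : ‖ψ‖ ^ 2 = ‖H1.value ψ‖ ^ 2 + ‖H1.grad ψ‖ ^ 2 :=
  WithLp.prod_norm_sq_eq_of_L2 (ψ : WithLp 2 (H0 d α × H0Vec d α))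

theorem H1.eq_zero_of_value_eq_zero {ψ : H1 d α} (h : H1.value ψ = 0) : ψ = 0 := by
  have hgrad : H1.grad ψ = 0 := H0Vec.eq_zero_of_forall_coordPairing_eq_zero fun φ hφ j => by
    have hj := mem_H1_iff.1 ψ.2 φ hφ j
    change IsTest.pairing _ (H1.value ψ) = -hφ.coordPairing j (H1.grad ψ) at hj
    rwa [h, map_zero, zero_eq_neg] at hj
  have hsq := H1.norm_sq_eq ψ
  rw [h, hgrad, norm_zero, norm_zero] at hsq
  exact norm_eq_zero.1 (by simpa using hsq)

theorem IsTest.isWeakGradient_gradient {η : Space d → ℝ} (hη : IsTest η) :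
    IsWeakGradient η (∇ η) := by
  intro φ hφ j
  simp only [gradient_apply]
  have hη' := (hη.fderiv_apply (basisVec j)).1.continuous
  have hφ' := hφ.fderiv_apply (basisVec j)
  exact integral_mul_fderiv_eq_neg_fderiv_mul_of_integrable
    ((hη'.mul hφ.1.continuous).integrable_of_hasCompactSupport hφ.2.mul_left)
    ((hη.1.continuous.mul hφ'.1.continuous).integrable_of_hasCompactSupport hφ'.2.mul_left)
    ((hη.1.continuous.mul hφ.1.continuous).integrable_of_hasCompactSupport hφ.2.mul_left)
    (fun x _ => hη.1.differentiable (by simp) x) (fun x _ => hφ.1.differentiable (by simp) x)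

theorem isWeakGradient_congr {ψ ψ' : Space d → ℝ} {g g' : Space d → Space d}
    (hψ : ψ =ᵐ[volume] ψ') (hg : g =ᵐ[volume] g') :
    IsWeakGradient ψ g ↔ IsWeakGradient ψ' g' := by
  refine forall_congr' fun φ => forall_congr' fun _ => forall_congr' fun j => ?_
  rw [integral_congr_ae (hψ.mono fun x hx => congrArg (· * fderiv ℝ φ x (basisVec j)) hx),
    integral_congr_ae (hg.mono fun x hx => congrArg (fun v : Space d => v j * φ x) hx)]

/-- A test function as an element of `H^{1,α}`. -/
def IsTest.toH1 {η : Space d → ℝ} (hη : IsTest η) : H1 d α :=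
  ⟨WithLp.toLp 2 (hη.memLp.toLp, hη.memLp_gradient.toLp),
    (isWeakGradient_congr (fieldMeasure_ae hη.memLp.coeFn_toLp)
      (fieldMeasure_ae hη.memLp_gradient.coeFn_toLp)).2 hη.isWeakGradient_gradient⟩

theorem IsTest.value_toH1 {η : Space d → ℝ} (hη : IsTest η) :
    H1.value (hη.toH1 (α := α)) =ᵐ[volume] η :=
  fieldMeasure_ae hη.memLp.coeFn_toLp

theorem IsTest.grad_toH1 {η : Space d → ℝ} (hη : IsTest η) :
    H1.grad (hη.toH1 (α := α)) =ᵐ[volume] ∇ η :=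
  fieldMeasure_ae hη.memLp_gradient.coeFn_toLp

end Sobolev

section Cutoff

open scoped SchwartzMap LineDeriv

variable {d : ℕ}

/-- A smooth cutoff function which equals `1` on the ball of radius `ε⁻¹`. -/
def cutoff (ε : ℝ) (x : Space d) : ℝ :=
  (⟨1, 2, one_pos, one_lt_two⟩ : ContDiffBump (0 : Space d)) (ε • x)

theorem cutoff_zero (x : Space d) : cutoff 0 x = 1 := by
  rw [cutoff, zero_smul]
  exact ContDiffBump.one_of_mem_closedBall _ (by simp)

theorem isTest_cutoff {ε : ℝ} (hε : ε ≠ 0) : IsTest (cutoff (d := d) ε) :=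
  ⟨(ContDiffBump.contDiff _).comp (contDiff_const_smul ε),
    (ContDiffBump.hasCompactSupport _).comp_homeomorph (Homeomorph.smulOfNeZero ε hε)⟩

theorem norm_cutoff_le (ε : ℝ) (x : Space d) : ‖cutoff ε x‖ ≤ 1 := by
  rw [cutoff, Real.norm_of_nonneg (ContDiffBump.nonneg _)]
  exact ContDiffBump.le_one _

theorem continuous_cutoff_left (x : Space d) : Continuous fun ε => cutoff ε x :=
  (ContDiffBump.continuous _).comp (continuous_id.smul continuous_const)

theorem exists_norm_fderiv_cutoff_le (d : ℕ) :
    ∃ C, ∀ (ε : ℝ) (x : Space d), ‖fderiv ℝ (cutoff ε) x‖ ≤ |ε| * C := by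
  let χ : ContDiffBump (0 : Space d) := ⟨1, 2, one_pos, one_lt_two⟩
  obtain ⟨C, hC⟩ := (χ.hasCompactSupport.fderiv ℝ).exists_bound_of_continuous
    (χ.contDiff.continuous_fderiv (n := ∞) (by simp))
  refine ⟨C, fun ε x => ?_⟩
  have h : fderiv ℝ (cutoff ε) x = ε • fderiv ℝ χ (ε • x) := fderiv_comp_smul ε
  rw [h, norm_smul, Real.norm_eq_abs]
  exact mul_le_mul_of_nonneg_left (hC _) (abs_nonneg ε)

theorem tendsto_integral_cutoff_mul {u : Space d → ℝ} (hu : Integrable u) :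
    Tendsto (fun ε => ∫ x, cutoff ε x * u x) (𝓝[≠] 0) (𝓝 (∫ x, u x)) := by
  refine tendsto_integral_filter_of_dominated_convergence (fun x => ‖u x‖) ?_ ?_ hu.norm ?_
  · filter_upwards [self_mem_nhdsWithin] with ε hε
    exact (isTest_cutoff hε).1.continuous.aestronglyMeasurable.mul hu.1
  · refine Eventually.of_forall fun ε => ae_of_all _ fun x => ?_
    rw [norm_mul]
    exact mul_le_of_le_one_left (norm_nonneg _) (norm_cutoff_le ε x)
  · refine ae_of_all _ fun x => ?_
    simpa only [cutoff_zero, one_mul] using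
      (((continuous_cutoff_left x).tendsto 0).mono_left nhdsWithin_le_nhds).mul_const (u x)

theorem tendsto_integral_fderiv_cutoff {V : Space d → Space d} (hV : Integrable V) :
    Tendsto (fun ε => ∫ x, fderiv ℝ (cutoff ε) x (V x)) (𝓝[≠] 0) (𝓝 0) := by
  obtain ⟨C, hC⟩ := exists_norm_fderiv_cutoff_le d
  have hlim : Tendsto (fun ε : ℝ => |ε| * C * ∫ x, ‖V x‖) (𝓝[≠] 0) (𝓝 0) := by
    have hc : Continuous fun ε : ℝ => |ε| * C * ∫ x, ‖V x‖ := by fun_prop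
    simpa using (hc.tendsto 0).mono_left nhdsWithin_le_nhds
  refine squeeze_zero_norm (fun ε => ?_) hlim
  refine (norm_integral_le_integral_norm _).trans ?_
  rw [← integral_const_mul]
  exact integral_mono_of_nonneg (ae_of_all _ fun x => norm_nonneg _)
    (hV.norm.const_mul _) (ae_of_all _ fun x => (fderiv ℝ (cutoff ε) x).le_of_opNorm_le (hC ε x) _)

theorem integrable_fderiv_cutoff {ε : ℝ} (hε : ε ≠ 0) {V : Space d → Space d}
    (hV : Integrable V) : Integrable fun x => fderiv ℝ (cutoff ε) x (V x) := by
  obtain ⟨C, hC⟩ := exists_norm_fderiv_cutoff_le d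
  have hcont := (isTest_cutoff (d := d) hε).1.continuous_fderiv (by simp)
  exact (hV.norm.const_mul (|ε| * C)).mono'
    ((ContinuousLinearMap.id ℝ (Space d →L[ℝ] ℝ)).aestronglyMeasurable_comp₂
      hcont.aestronglyMeasurable hV.1)
    (ae_of_all _ fun x => (fderiv ℝ (cutoff ε) x).le_of_opNorm_le (hC ε x) _)

/-- The products `χ_ε φ` with the cutoffs `χ_ε` are test functions, and the error
`∫ φ ∇χ_ε · G` vanishes as `ε → 0` because `|∇χ_ε| ≤ C ε`. -/
theorem IsWeakDivergence.integral_fderiv_eq {G : Space d → Space d} {h φ : Space d → ℝ}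
    (hG : IsWeakDivergence G h) (hφ : ContDiff ℝ ∞ φ) (hhφ : Integrable fun x => h x * φ x)
    (hdφ : Integrable fun x => fderiv ℝ φ x (G x)) (hφG : Integrable fun x => φ x • G x) :
    ∫ x, fderiv ℝ φ x (G x) = -∫ x, h x * φ x := by
  have hcut : ∀ ε : ℝ, ε ≠ 0 → (∫ x, cutoff ε x * fderiv ℝ φ x (G x)) +
      ∫ x, fderiv ℝ (cutoff ε) x (φ x • G x) = -∫ x, cutoff ε x * (h x * φ x) := by
    intro ε hε
    have hχ := isTest_cutoff (d := d) hε
    have hprod := hG _ (hχ.mul_left hφ)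
    rw [← integral_add (hdφ.bdd_mul hχ.1.continuous.aestronglyMeasurable
      (ae_of_all _ (norm_cutoff_le ε))) (integrable_fderiv_cutoff hε hφG)]
    refine Eq.trans (integral_congr_ae (ae_of_all _ fun x => ?_)) (hprod.trans ?_)
    · rw [fderiv_fun_mul (hχ.1.differentiable (by simp) x) (hφ.differentiable (by simp) x)]
      simp only [add_apply, smul_apply, smul_eq_mul, map_smul]
    · simp only [mul_left_comm]
  refine tendsto_nhds_unique (f := fun ε => (∫ x, cutoff ε x * fderiv ℝ φ x (G x)) +
    ∫ x, fderiv ℝ (cutoff ε) x (φ x • G x)) ?_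
    (Tendsto.congr' ?_ (tendsto_integral_cutoff_mul hhφ).neg)
  · simpa only [add_zero] using
      (tendsto_integral_cutoff_mul hdφ).add (tendsto_integral_fderiv_cutoff hφG)
  · filter_upwards [self_mem_nhdsWithin] with ε hε using (hcut ε hε).symm

end Cutoff

section Schwartz

open scoped SchwartzMap LineDeriv

variable {d : ℕ} {α μ : ℝ}

theorem memLp_two_fieldMeasure_schwartz {F : Type*} [NormedAddCommGroup F] [NormedSpace ℝ F]
    (φ : 𝓢(Space d, F)) : MemLp φ 2 (fieldMeasure d α) := by
  have hw : Function.HasTemperateGrowth (weight (d := d) α) :=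
    Function.hasTemperateGrowth_one_add_norm_sq_rpow _ α
  have hprod := ((SchwartzMap.smulLeftCLM F (weight α) φ).memLp 2).norm.integrable_mul
    (φ.memLp 2).norm
  rw [memLp_two_fieldMeasure_iff φ.continuous.aestronglyMeasurable]
  refine hprod.congr (ae_of_all _ fun x => ?_)
  simp only [Pi.mul_apply, SchwartzMap.smulLeftCLM_apply_apply hw, norm_smul,
    Real.norm_of_nonneg (weight_pos α x).le]
  ring

section Resolvent

variable {E : Type*} [NormedAddCommGroup E] [InnerProductSpace ℝ E]

/-- The Fourier symbol `(μ + (2π)² |ξ|²)⁻¹` of the resolvent `(μ - Δ)⁻¹`. -/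
def resolventSymbol (μ : ℝ) (ξ : E) : ℝ := (μ + (2 * Real.pi) ^ 2 * ‖ξ‖ ^ 2)⁻¹

theorem hasTemperateGrowth_resolventSymbol (hμ : 0 < μ) :
    (resolventSymbol (E := E) μ).HasTemperateGrowth := by
  have hscale := ((2 * Real.pi / √μ) • ContinuousLinearMap.id ℝ E).hasTemperateGrowth
  refine (congrArg _ (funext fun ξ => ?_)).mp ((Function.HasTemperateGrowth.const μ⁻¹).mul
    ((Function.hasTemperateGrowth_one_add_norm_sq_rpow E (-1)).comp hscale))
  have hsq : ‖(2 * Real.pi / √μ) • ξ‖ ^ 2 = (2 * Real.pi) ^ 2 / μ * ‖ξ‖ ^ 2 := by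
    rw [norm_smul, mul_pow, Real.norm_eq_abs, sq_abs, div_pow, Real.sq_sqrt hμ.le]
  simp only [resolventSymbol, Function.comp_apply, smul_apply, ContinuousLinearMap.id_apply,
    Pi.mul_apply, Real.rpow_neg_one]
  rw [hsq, ← mul_inv, mul_add, mul_one, ← mul_assoc, mul_div_cancel₀ _ hμ.ne']

theorem exists_schwartz_smul_sub_laplacian_eq_complex [FiniteDimensional ℝ E]
    [MeasurableSpace E] [BorelSpace E] (hμ : 0 < μ) (η : 𝓢(E, ℂ)) :
    ∃ φ : 𝓢(E, ℂ), μ • φ - Δ φ = η := by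
  have hσ := hasTemperateGrowth_resolventSymbol (E := E) hμ
  have hnorm : Function.HasTemperateGrowth fun ξ : E => ‖ξ‖ ^ 2 := by fun_prop
  refine ⟨SchwartzMap.fourierMultiplierCLM ℂ (resolventSymbol μ) η, ?_⟩
  rw [SchwartzMap.laplacian_eq_fourierMultiplierCLM,
    SchwartzMap.fourierMultiplierCLM_fourierMultiplierCLM_apply hnorm hσ]
  simp only [SchwartzMap.fourierMultiplierCLM_apply]
  rw [← FourierTransform.fourierInv_smul, ← FourierTransform.fourierInv_smul, sub_eq_add_neg,
    ← FourierTransform.fourierInv_neg, ← FourierTransform.fourierInv_add]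
  refine Eq.trans (congrArg _ ?_) (FourierTransform.fourierInv_fourier_eq η)
  ext ξ
  have hpos : 0 < μ + (2 * Real.pi) ^ 2 * ‖ξ‖ ^ 2 := by positivity
  simp only [add_apply, smul_apply, SchwartzMap.smulLeftCLM_apply_apply hσ,
    SchwartzMap.smulLeftCLM_apply_apply (hnorm.mul hσ), Pi.mul_apply, smul_smul, ← neg_smul,
    neg_neg, ← add_smul]
  rw [← mul_assoc, ← add_mul, resolventSymbol, mul_inv_cancel₀ hpos.ne', one_smul]

theorem exists_schwartz_smul_sub_laplacian_eq [FiniteDimensional ℝ E] [MeasurableSpace E]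
    [BorelSpace E] (hμ : 0 < μ) (η : 𝓢(E, ℝ)) : ∃ φ : 𝓢(E, ℝ), ∀ x, μ * φ x - Δ φ x = η x := by
  obtain ⟨φ, hφ⟩ := exists_schwartz_smul_sub_laplacian_eq_complex hμ
    (SchwartzMap.postcompCLM Complex.ofRealCLM η)
  refine ⟨SchwartzMap.postcompCLM Complex.reCLM φ, fun x => ?_⟩
  have hΔ : Δ (SchwartzMap.postcompCLM Complex.reCLM φ) x = (Δ φ x).re := by
    rw [SchwartzMap.laplacian_apply, SchwartzMap.laplacian_apply]
    exact (φ.contDiffAt 2).laplacian_CLM_comp_left (l := Complex.reCLM)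
  have hx := congrArg Complex.re (DFunLike.congr_fun hφ x)
  simpa [hΔ] using hx

end Resolvent

theorem integrable_mul_schwartz {f : Space d → ℝ} (hf : MemLp f 2 (fieldMeasure d α))
    (φ : 𝓢(Space d, ℝ)) : Integrable fun x => f x * φ x :=
  integrable_bilin_of_memLp (ContinuousLinearMap.mul ℝ ℝ).flip
    (memLp_two_fieldMeasure_schwartz φ) hf

theorem IsWeakDivergence.integral_fderiv_schwartz_eq {G : Space d → Space d} {h : Space d → ℝ}
    (hG : IsWeakDivergence G h) (hG2 : MemLp G 2 (fieldMeasure d α))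
    (hh2 : MemLp h 2 (fieldMeasure d α)) (φ : 𝓢(Space d, ℝ)) :
    ∫ x, fderiv ℝ φ x (G x) = -∫ x, h x * φ x :=
  hG.integral_fderiv_eq φ.smooth' (integrable_mul_schwartz hh2 φ)
    (integrable_bilin_of_memLp (ContinuousLinearMap.id ℝ (Space d →L[ℝ] ℝ))
      (memLp_two_fieldMeasure_schwartz (SchwartzMap.fderivCLM ℝ _ _ φ)) hG2)
    (integrable_bilin_of_memLp (ContinuousLinearMap.lsmul ℝ ℝ)
      (memLp_two_fieldMeasure_schwartz φ) hG2)

theorem integral_mul_laplacian_schwartz_eq (ψ : H1 d α) (φ : 𝓢(Space d, ℝ)) :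
    ∫ x, H1.value ψ x * Δ φ x = -∫ x, fderiv ℝ φ x (H1.grad ψ x) := by
  have hpart : ∀ j, ∫ x, H1.value ψ x * (∂_{basisVec j} (∂_{basisVec j} φ) : 𝓢(Space d, ℝ)) x =
      -∫ x, H1.grad ψ x j * (∂_{basisVec j} φ : 𝓢(Space d, ℝ)) x := by
    intro j
    have hj := (isWeakGradient_iff_isWeakDivergence.1 (H1.isWeakGradient ψ)
      j).integral_fderiv_schwartz_eq ((ContinuousLinearMap.toSpanSingleton ℝ
        (basisVec j)).comp_memLp' (Lp.memLp (H1.value ψ)))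
      (memLp_coord (H1.grad ψ) j) (∂_{basisVec j} φ)
    simp only [map_smul, smul_eq_mul] at hj
    exact hj
  have hsplit : ∀ x, fderiv ℝ φ x (H1.grad ψ x) =
      ∑ j, H1.grad ψ x j * (∂_{basisVec j} φ : 𝓢(Space d, ℝ)) x := fun x => by
    conv_lhs => rw [← sum_apply_smul_basisVec (H1.grad ψ x), map_sum]
    simp only [map_smul, smul_eq_mul, SchwartzMap.lineDerivOp_apply_eq_fderiv]
  have hΔ : Δ φ = ∑ j : Fin d, (∂_{basisVec j} (∂_{basisVec j} φ) : 𝓢(Space d, ℝ)) := by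
    simpa only [EuclideanSpace.basisFun_apply, basisVec] using
      SchwartzMap.laplacian_eq_sum (EuclideanSpace.basisFun (Fin d) ℝ) φ
  simp only [hsplit, hΔ, sum_apply, Finset.mul_sum]
  rw [integral_finsetSum _ fun j _ => integrable_mul_schwartz (Lp.memLp _) _,
    integral_finsetSum _ fun j _ => integrable_mul_schwartz (memLp_coord _ j) _,
    ← Finset.sum_neg_distrib]
  exact Finset.sum_congr rfl fun j _ => hpart j

theorem H1.eq_zero_of_isWeakDivergence_smul (hμ : 0 < μ) {ψ : H1 d α}
    (h : IsWeakDivergence (H1.grad ψ) ⇑(μ • H1.value ψ)) : ψ = 0 := by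
  refine H1.eq_zero_of_value_eq_zero (H0.eq_zero_of_forall_pairing_eq_zero fun η hη => ?_)
  obtain ⟨φ, hφ⟩ : ∃ φ : 𝓢(Space d, ℝ), ∀ x, μ * φ x - Δ φ x = η x :=
    exists_schwartz_smul_sub_laplacian_eq hμ (hη.2.toSchwartzMap hη.1)
  have hη_eq : ∀ x, H1.value ψ x * η x = μ * (H1.value ψ x * φ x) - H1.value ψ x * Δ φ x :=
    fun x => by linear_combination (-H1.value ψ x) * hφ x
  have hsmul : ∫ x, (μ • H1.value ψ) x * φ x = μ * ∫ x, H1.value ψ x * φ x := by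
    rw [← integral_const_mul]
    refine integral_congr_ae ?_
    filter_upwards [fieldMeasure_ae (Lp.coeFn_smul μ (H1.value ψ))] with x hx
    rw [hx, Pi.smul_apply, smul_eq_mul, mul_assoc]
  have hdiv := h.integral_fderiv_schwartz_eq (Lp.memLp _) (Lp.memLp _) φ
  rw [hη.pairing_apply]
  simp only [hη_eq]
  rw [integral_sub ((integrable_mul_schwartz (Lp.memLp _) φ).const_mul μ)
    (integrable_mul_schwartz (Lp.memLp _) (Δ φ)), integral_const_mul,
    integral_mul_laplacian_schwartz_eq, hdiv, hsmul]
  ring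

end Schwartz

/-! ### The elliptic equation `λ² ψ - Δψ = f` -/

section Drift

variable {d : ℕ} {α : ℝ}

/-- The logarithmic gradient `∇w / w` of the weight `w(x) = (1 + |x|²)^α`. -/
def logGrad (α : ℝ) (x : Space d) : Space d := (2 * α / (1 + ‖x‖ ^ 2)) • x

theorem continuous_logGrad (α : ℝ) : Continuous (logGrad (d := d) α) := by
  have h : Continuous fun x : Space d => 2 * α / (1 + ‖x‖ ^ 2) :=
    continuous_const.div (by fun_prop) fun x => by positivity
  exact h.smul continuous_id

theorem norm_logGrad_le (α : ℝ) (x : Space d) : ‖logGrad α x‖ ≤ |α| := by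
  have h : 0 < 1 + ‖x‖ ^ 2 := by positivity
  rw [logGrad, norm_smul, Real.norm_eq_abs, abs_div, abs_of_pos h, abs_mul, abs_two,
    div_mul_eq_mul_div, div_le_iff₀ h]
  nlinarith [abs_nonneg α, sq_nonneg (‖x‖ - 1)]

theorem fderiv_weight_apply (x v : Space d) :
    fderiv ℝ (weight α) x v = weight α x * inner ℝ (logGrad α x) v := by
  have hpos : 0 < 1 + ‖x‖ ^ 2 := by positivity
  have hbase : HasFDerivAt (fun y : Space d => 1 + ‖y‖ ^ 2) (2 • innerSL ℝ x) x :=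
    (hasStrictFDerivAt_norm_sq x).hasFDerivAt.const_add 1
  have hfderiv : fderiv ℝ (weight α) x = (α * (1 + ‖x‖ ^ 2) ^ (α - 1)) • (2 • innerSL ℝ x) :=
    (hbase.rpow_const (p := α) (Or.inl hpos.ne')).fderiv
  rw [hfderiv, logGrad, weight, Real.rpow_sub_one hpos.ne', real_inner_smul_left]
  simp only [smul_apply, innerSL_apply_apply, smul_eq_mul, nsmul_eq_mul, Nat.cast_ofNat]
  field_simp

theorem fderiv_weight_mul_apply {η : Space d → ℝ} (hη : Differentiable ℝ η) (x v : Space d) :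
    fderiv ℝ (fun y => weight α y * η y) x v =
      weight α x * (fderiv ℝ η x v + η x * inner ℝ (logGrad α x) v) := by
  rw [fderiv_fun_mul ((contDiff_weight α).differentiable (by simp) x) (hη x)]
  simp only [add_apply, smul_apply, smul_eq_mul, fderiv_weight_apply]
  ring

theorem memLp_top_logGrad : MemLp (logGrad α) ⊤ (fieldMeasure d α) :=
  memLp_top_of_bound (continuous_logGrad α).aestronglyMeasurable |α|
    (ae_of_all _ (norm_logGrad_le α))

/-- The operator `g ↦ (∇w / w) · g`, the error in the integration by parts with respect to the
weight `w`. -/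
def drift (d : ℕ) (α : ℝ) : H0Vec d α →L[ℝ] H0 d α :=
  (innerSL ℝ).holderL (fieldMeasure d α) ⊤ 2 2 memLp_top_logGrad.toLp

theorem drift_ae_eq (g : H0Vec d α) :
    ∀ᵐ x, drift d α g x = inner ℝ (logGrad α x) (g x) := by
  filter_upwards [fieldMeasure_ae ((innerSL ℝ).coeFn_holder (r := 2) memLp_top_logGrad.toLp g),
    fieldMeasure_ae memLp_top_logGrad.coeFn_toLp] with x hx hlog
  rw [← hlog]
  exact hx

theorem norm_drift_le (g : H0Vec d α) : ‖drift d α g‖ ≤ |α| * ‖g‖ := by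
  refine Lp.norm_le_mul_norm_of_ae_le_mul (ae_fieldMeasure_iff.2 ?_)
  filter_upwards [drift_ae_eq g] with x hx
  rw [hx]
  exact (norm_inner_le_norm _ _).trans
    (mul_le_mul_of_nonneg_right (norm_logGrad_le α x) (norm_nonneg _))

theorem neg_mul_le_inner_drift (g : H0Vec d α) (f : H0 d α) :
    -(|α| * ‖g‖ * ‖f‖) ≤ inner ℝ (drift d α g) f :=
  (neg_le_neg (mul_le_mul_of_nonneg_right (norm_drift_le g) (norm_nonneg f))).trans
    (abs_le.1 (abs_real_inner_le_norm _ f)).1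

end Drift

section Elliptic

variable {d : ℕ} {α : ℝ}

theorem IsTest.weight_mul {φ : Space d → ℝ} (hφ : IsTest φ) (β : ℝ) :
    IsTest fun x => weight β x * φ x := by
  simpa only [mul_comm] using hφ.mul_left (contDiff_weight β)

/-- The weak form of `div g = h` in the weighted spaces: it is tested with all of `H^{1,α}` in the
weighted inner product. -/
def IsWeightedDivergence (g : H0Vec d α) (h : H0 d α) : Prop :=
  ∀ χ : H1 d α, inner ℝ g (H1.grad χ) + inner ℝ (drift d α g) (H1.value χ) =
    -inner ℝ h (H1.value χ)

theorem inner_value_toH1 {η : Space d → ℝ} (hη : IsTest η) (h : H0 d α) :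
    inner ℝ h (H1.value hη.toH1) = ∫ x, h x * (weight α x * η x) := by
  rw [L2.inner_def, integral_fieldMeasure]
  refine integral_congr_ae ?_
  filter_upwards [hη.value_toH1 (α := α)] with x hx
  rw [hx, smul_eq_mul]
  change weight α x * (η x * h x) = _
  ring

theorem inner_grad_toH1_add_inner_drift {η : Space d → ℝ} (hη : IsTest η) (g : H0Vec d α) :
    inner ℝ g (H1.grad hη.toH1) + inner ℝ (drift d α g) (H1.value hη.toH1) =
      ∫ x, fderiv ℝ (fun y => weight α y * η y) x (g x) := by
  rw [L2.inner_def, L2.inner_def, ← integral_add (L2.integrable_inner _ _)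
    (L2.integrable_inner _ _), integral_fieldMeasure]
  refine integral_congr_ae ?_
  filter_upwards [hη.value_toH1 (α := α), hη.grad_toH1 (α := α), drift_ae_eq g]
    with x hvalue hgrad hdrift
  rw [hvalue, hgrad, hdrift, fderiv_weight_mul_apply (hη.1.differentiable (by simp)),
    real_inner_comm, inner_gradient]
  rfl

theorem IsWeightedDivergence.isWeakDivergence {g : H0Vec d α} {h : H0 d α}
    (hg : IsWeightedDivergence g h) : IsWeakDivergence g h := by
  intro φ hφ
  have hη := hφ.weight_mul (-α)
  have hcancel : ∀ x, weight α x * (weight (-α) x * φ x) = φ x := fun x => by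
    rw [← mul_assoc, mul_comm (weight α x), weight_neg_mul_weight, one_mul]
  have hweighted := hg hη.toH1
  rw [inner_grad_toH1_add_inner_drift, inner_value_toH1] at hweighted
  simpa only [hcancel] using hweighted

/-- The weighted form of the operator `μ - Δ`. -/
def resolventForm (d : ℕ) (α μ : ℝ) : H1 d α →L[ℝ] H1 d α →L[ℝ] ℝ :=
  let P : H1 d α →L[ℝ] H0 d α := H1.value
  let Q : H1 d α →L[ℝ] H0Vec d α := H1.grad
  μ • (innerSL ℝ).bilinearComp P P + (innerSL ℝ).bilinearComp Q Q +
    (innerSL ℝ).bilinearComp ((drift d α).comp Q) P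

theorem resolventForm_apply (μ : ℝ) (ψ χ : H1 d α) :
    resolventForm d α μ ψ χ = μ * inner ℝ (H1.value ψ) (H1.value χ) +
      inner ℝ (H1.grad ψ) (H1.grad χ) + inner ℝ (drift d α (H1.grad ψ)) (H1.value χ) := rfl

theorem isCoercive_resolventForm {μ : ℝ} (hμ : 1 + α ^ 2 ≤ μ) :
    IsCoercive (resolventForm d α μ) := by
  refine ⟨1 / 2, by norm_num, fun ψ => ?_⟩
  rw [resolventForm_apply, real_inner_self_eq_norm_sq, real_inner_self_eq_norm_sq, mul_assoc,
    ← pow_two, H1.norm_sq_eq]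
  nlinarith [neg_mul_le_inner_drift (H1.grad ψ) (H1.value ψ),
    sq_nonneg (|α| * ‖H1.value ψ‖ - ‖H1.grad ψ‖), sq_abs α, sq_nonneg ‖H1.value ψ‖,
    mul_le_mul_of_nonneg_right hμ (sq_nonneg ‖H1.value ψ‖)]

theorem exists_isWeightedDivergence {μ : ℝ} (hμ : 1 + α ^ 2 ≤ μ) (f : H0 d α) :
    ∃ ψ : H1 d α, IsWeightedDivergence (H1.grad ψ) (μ • H1.value ψ - f) := by
  have hcoercive := isCoercive_resolventForm (d := d) hμ
  obtain ⟨ψ, hψ⟩ : ∃ ψ, ∀ χ, resolventForm d α μ ψ χ = inner ℝ f (H1.value χ) := by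
    refine ⟨hcoercive.continuousLinearEquivOfBilin.symm
      ((InnerProductSpace.toDual ℝ (H1 d α)).symm ((innerSL ℝ f).comp H1.value)), fun χ => ?_⟩
    rw [← hcoercive.continuousLinearEquivOfBilin_apply, ContinuousLinearEquiv.apply_symm_apply,
      InnerProductSpace.toDual_symm_apply]
    rfl
  refine ⟨ψ, fun χ => ?_⟩
  rw [inner_sub_left, real_inner_smul_left]
  linear_combination (resolventForm_apply μ ψ χ).symm.trans (hψ χ)

/-- Weak solutions of `Δψ = h` in `H^{1,α}` may be tested with all of `H^{1,α}`: `ψ` solves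
`μψ - Δψ = μψ - h`, so does the variational solution of this equation, and there is only one. -/
theorem H1.isWeightedDivergence_iff {ψ : H1 d α} {h : H0 d α} :
    IsWeightedDivergence (H1.grad ψ) h ↔ IsWeakDivergence (H1.grad ψ) h := by
  refine ⟨IsWeightedDivergence.isWeakDivergence, fun hψ => ?_⟩
  set μ := 1 + α ^ 2 with hμ
  obtain ⟨χ, hχ⟩ := exists_isWeightedDivergence hμ.ge (μ • H1.value ψ - h)
  have hdiff : IsWeakDivergence (H1.grad (χ - ψ)) ⇑(μ • H1.value (χ - ψ)) := by
    rw [isWeakDivergence_iff] at hψ ⊢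
    intro φ hφ
    have hχφ := isWeakDivergence_iff.1 hχ.isWeakDivergence φ hφ
    simp only [map_sub, map_smul, hχφ, hψ φ hφ, smul_eq_mul]
    ring
  have hχψ : χ = ψ := sub_eq_zero.1 (H1.eq_zero_of_isWeakDivergence_smul (by positivity) hdiff)
  rw [hχψ, sub_sub_cancel] at hχ
  exact hχ

theorem H1.isWeakDivergence_iff_integral_laplacian {ψ : H1 d α} {h : Space d → ℝ} :
    IsWeakDivergence (H1.grad ψ) h ↔
      ∀ φ : Space d → ℝ, IsTest φ → ∫ x, h x * φ x = ∫ x, H1.value ψ x * Δ φ x := by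
  refine forall₂_congr fun φ hφ => ?_
  have hgreen := integral_mul_laplacian_schwartz_eq ψ (hφ.2.toSchwartzMap hφ.1)
  simp only [SchwartzMap.laplacian_apply] at hgreen
  change ∫ x, H1.value ψ x * Δ φ x = -∫ x, fderiv ℝ φ x (H1.grad ψ x) at hgreen
  rw [hgreen, eq_comm, neg_eq_iff_eq_neg]

end Elliptic

/-! ### Schur test and the coupling operators -/

section Schur

variable {X Y : Type*} [MeasurableSpace X] [MeasurableSpace Y] {μ : Measure X} {ν : Measure Y}
variable {F G : Type*} [NormedAddCommGroup F] [NormedSpace ℝ F]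
variable [NormedAddCommGroup G] [NormedSpace ℝ G]

theorem sq_lintegral_mul_le {k u : Y → ℝ≥0∞} (hk : Measurable k) (hu : Measurable u) :
    (∫⁻ y, k y * u y ∂ν) ^ 2 ≤ (∫⁻ y, k y ∂ν) * ∫⁻ y, k y * u y ^ 2 ∂ν := by
  have hsqrt : ∀ a : ℝ≥0∞, a ^ (1 / 2 : ℝ) * a ^ (1 / 2 : ℝ) = a := fun a => by
    rw [← ENNReal.rpow_add_of_nonneg _ _ (by norm_num) (by norm_num)]; norm_num
  have hsq : ∀ a : ℝ≥0∞, (a ^ (1 / 2 : ℝ)) ^ 2 = a := fun a => by rw [pow_two, hsqrt]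
  have hcs := ENNReal.lintegral_mul_le_Lp_mul_Lq ν Real.HolderConjugate.two_two
    (f := fun y => k y ^ (1 / 2 : ℝ)) (g := fun y => k y ^ (1 / 2 : ℝ) * u y)
    (hk.pow_const _).aemeasurable ((hk.pow_const _).mul hu).aemeasurable
  simp only [Pi.mul_apply, ← mul_assoc, hsqrt, ENNReal.rpow_two, mul_pow, hsq] at hcs
  calc (∫⁻ y, k y * u y ∂ν) ^ 2 ≤ _ := pow_le_pow_left' hcs 2
    _ = _ := by rw [mul_pow, hsq, hsq]

theorem lintegral_sq_lintegral_mul_le [SFinite μ] [SFinite ν] {k : X → Y → ℝ≥0∞}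
    (hk : Measurable (Function.uncurry k)) {u w : Y → ℝ≥0∞} (hu : Measurable u) {A B : ℝ≥0∞}
    (hBt : B ≠ ⊤) (hA : ∀ x, ∫⁻ y, k x y ∂ν ≤ A) (hB : ∀ y, ∫⁻ x, k x y ∂μ ≤ B * w y) :
    ∫⁻ x, (∫⁻ y, k x y * u y ∂ν) ^ 2 ∂μ ≤ A * B * ∫⁻ y, w y * u y ^ 2 ∂ν := by
  have hku : Measurable (Function.uncurry fun x y => k x y * u y ^ 2) :=
    hk.mul ((hu.comp measurable_snd).pow_const 2)
  have hkx : ∀ x, Measurable (k x) := fun x => hk.comp measurable_prodMk_left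
  have hky : ∀ y, Measurable fun x => k x y := fun y => hk.comp measurable_prodMk_right
  calc ∫⁻ x, (∫⁻ y, k x y * u y ∂ν) ^ 2 ∂μ
      ≤ ∫⁻ x, A * ∫⁻ y, k x y * u y ^ 2 ∂ν ∂μ := lintegral_mono fun x =>
        (sq_lintegral_mul_le (hkx x) hu).trans (by gcongr; exact hA x)
    _ = A * ∫⁻ y, ∫⁻ x, k x y * u y ^ 2 ∂μ ∂ν := by
        rw [lintegral_const_mul _ hku.lintegral_prod_right,
          lintegral_lintegral_swap hku.aemeasurable]
    _ ≤ A * ∫⁻ y, B * (w y * u y ^ 2) ∂ν := by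
        gcongr with y
        rw [lintegral_mul_const _ (hky y), ← mul_assoc]
        gcongr
        exact hB y
    _ = A * B * ∫⁻ y, w y * u y ^ 2 ∂ν := by
        rw [mul_assoc, lintegral_const_mul' _ _ hBt]

theorem eLpNorm_two_sq {E : Type*} [NormedAddCommGroup E] (f : X → E) :
    eLpNorm f 2 μ ^ 2 = ∫⁻ x, ‖f x‖ₑ ^ 2 ∂μ := by
  simpa using eLpNorm_nnreal_pow_eq_lintegral (f := f) (μ := μ) (p := 2) (by norm_num)

/-- Operator-valued kernels satisfying the hypotheses of Schur's test for an operator from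
`L²(w ν)` to `L²(μ)`. -/
structure IsSchurKernel (k : X → Y → F →L[ℝ] G) (μ : Measure X) (ν : Measure Y)
    (w : Y → ℝ≥0∞) : Prop where
  stronglyMeasurable : StronglyMeasurable (Function.uncurry k)
  measurable_weight : Measurable w
  weight_ne_zero : ∀ y, w y ≠ 0
  exists_lintegral_le : ∃ A ≠ ⊤, ∀ x, ∫⁻ y, ‖k x y‖ₑ ∂ν ≤ A
  exists_lintegral_le_weight : ∃ B ≠ ⊤, ∀ y, ∫⁻ x, ‖k x y‖ₑ ∂μ ≤ B * w y

namespace IsSchurKernel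

variable {k : X → Y → F →L[ℝ] G} {w : Y → ℝ≥0∞}

theorem ae_of_ae_withDensity (hk : IsSchurKernel k μ ν w) {p : Y → Prop}
    (h : ∀ᵐ y ∂ν.withDensity w, p y) : ∀ᵐ y ∂ν, p y :=
  ((ae_withDensity_iff hk.measurable_weight).1 h).mono fun y hy => hy (hk.weight_ne_zero y)

theorem stronglyMeasurable_apply (hk : IsSchurKernel k μ ν w) (f : Lp F 2 (ν.withDensity w)) :
    StronglyMeasurable (Function.uncurry fun x y => k x y (f y)) :=
  isBoundedBilinearMap_apply.continuous.comp_stronglyMeasurable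
    (hk.stronglyMeasurable.prodMk ((Lp.stronglyMeasurable f).comp_measurable measurable_snd))

theorem exists_lintegral_sq_le [SFinite μ] [SFinite ν] (hk : IsSchurKernel k μ ν w) :
    ∃ C ≠ ⊤, ∀ f : Lp F 2 (ν.withDensity w),
      ∫⁻ x, (∫⁻ y, ‖k x y (f y)‖ₑ ∂ν) ^ 2 ∂μ ≤ C * eLpNorm f 2 (ν.withDensity w) ^ 2 := by
  obtain ⟨A, hAt, hA⟩ := hk.exists_lintegral_le
  obtain ⟨B, hBt, hB⟩ := hk.exists_lintegral_le_weight
  refine ⟨A * B, ENNReal.mul_ne_top hAt hBt, fun f => ?_⟩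
  have hf : Measurable fun y => ‖f y‖ₑ := (Lp.stronglyMeasurable f).enorm
  calc ∫⁻ x, (∫⁻ y, ‖k x y (f y)‖ₑ ∂ν) ^ 2 ∂μ
      ≤ ∫⁻ x, (∫⁻ y, ‖k x y‖ₑ * ‖f y‖ₑ ∂ν) ^ 2 ∂μ := by
        gcongr with x y
        exact (k x y).le_opENorm (f y)
    _ ≤ A * B * ∫⁻ y, w y * ‖f y‖ₑ ^ 2 ∂ν :=
        lintegral_sq_lintegral_mul_le hk.stronglyMeasurable.enorm hf hBt hA hB
    _ = A * B * eLpNorm f 2 (ν.withDensity w) ^ 2 := by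
        rw [eLpNorm_two_sq, lintegral_withDensity_eq_lintegral_mul _ hk.measurable_weight
          (hf.pow_const 2)]
        rfl

theorem ae_integrable [SFinite μ] [SFinite ν] (hk : IsSchurKernel k μ ν w)
    (f : Lp F 2 (ν.withDensity w)) : ∀ᵐ x ∂μ, Integrable (fun y => k x y (f y)) ν := by
  obtain ⟨C, hCt, hC⟩ := hk.exists_lintegral_sq_le
  have hmeas := hk.stronglyMeasurable_apply f
  have hfinite : ∫⁻ x, (∫⁻ y, ‖k x y (f y)‖ₑ ∂ν) ^ 2 ∂μ ≠ ⊤ :=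
    ne_top_of_le_ne_top (ENNReal.mul_ne_top hCt (ENNReal.pow_ne_top (Lp.eLpNorm_ne_top f))) (hC f)
  filter_upwards [ae_lt_top (hmeas.enorm.lintegral_prod_right.pow_const 2) hfinite] with x hx
  refine ⟨(hmeas.comp_measurable measurable_prodMk_left).aestronglyMeasurable, ?_⟩
  exact lt_top_iff_ne_top.2 fun h => hx.ne (by simpa using h)

theorem exists_eLpNorm_integral_le [SFinite μ] [SFinite ν] (hk : IsSchurKernel k μ ν w) :
    ∃ C ≠ ⊤, ∀ f : Lp F 2 (ν.withDensity w),
      eLpNorm (fun x => ∫ y, k x y (f y) ∂ν) 2 μ ≤ C * eLpNorm f 2 (ν.withDensity w) := by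
  obtain ⟨C, hCt, hC⟩ := hk.exists_lintegral_sq_le
  refine ⟨C ^ (1 / 2 : ℝ), ENNReal.rpow_ne_top_of_nonneg (by norm_num) hCt, fun f => ?_⟩
  rw [← ENNReal.pow_le_pow_left_iff two_ne_zero, mul_pow, ← ENNReal.rpow_natCast (C ^ _),
    ← ENNReal.rpow_mul, eLpNorm_two_sq]
  norm_num only [ENNReal.rpow_one]
  refine le_trans (lintegral_mono fun x => ?_) (hC f)
  gcongr
  exact enorm_integral_le_lintegral_enorm _

theorem memLp_integral [SFinite μ] [SFinite ν] (hk : IsSchurKernel k μ ν w)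
    (f : Lp F 2 (ν.withDensity w)) : MemLp (fun x => ∫ y, k x y (f y) ∂ν) 2 μ := by
  obtain ⟨C, hCt, hC⟩ := hk.exists_eLpNorm_integral_le
  exact ⟨(hk.stronglyMeasurable_apply f).integral_prod_right.aestronglyMeasurable,
    (hC f).trans_lt (ENNReal.mul_lt_top hCt.lt_top (Lp.eLpNorm_lt_top f))⟩

/-- The operator `f ↦ ∫ k(·, y) f(y) dν(y)` from `L²(w ν)` to `L²(μ)`, which is bounded by Schur's
test. -/
def toLp [SFinite μ] [SFinite ν] (hk : IsSchurKernel k μ ν w) :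
    Lp F 2 (ν.withDensity w) →L[ℝ] Lp G 2 μ :=
  LinearMap.mkContinuousOfExistsBound
    { toFun := fun f => (hk.memLp_integral f).toLp
      map_add' := fun f g => by
        rw [← MemLp.toLp_add, MemLp.toLp_eq_toLp_iff]
        filter_upwards [hk.ae_integrable f, hk.ae_integrable g] with x hf hg
        rw [Pi.add_apply, ← integral_add hf hg]
        refine integral_congr_ae ?_
        filter_upwards [hk.ae_of_ae_withDensity (Lp.coeFn_add f g)] with y hy
        rw [hy, Pi.add_apply, map_add]
      map_smul' := fun a f => by
        rw [RingHom.id_apply, ← MemLp.toLp_const_smul, MemLp.toLp_eq_toLp_iff]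
        refine ae_of_all _ fun x => ?_
        rw [Pi.smul_apply, ← integral_smul]
        refine integral_congr_ae ?_
        filter_upwards [hk.ae_of_ae_withDensity (Lp.coeFn_smul a f)] with y hy
        rw [hy, Pi.smul_apply, map_smul] } <| by
    obtain ⟨C, hCt, hC⟩ := hk.exists_eLpNorm_integral_le
    refine ⟨C.toReal, fun f => ?_⟩
    rw [LinearMap.coe_mk, AddHom.coe_mk, Lp.norm_toLp, Lp.norm_def, ← ENNReal.toReal_mul]
    exact ENNReal.toReal_mono (ENNReal.mul_ne_top hCt (Lp.eLpNorm_ne_top f)) (hC f)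

theorem toLp_ae_eq [SFinite μ] [SFinite ν] (hk : IsSchurKernel k μ ν w)
    (f : Lp F 2 (ν.withDensity w)) : hk.toLp f =ᵐ[μ] fun x => ∫ y, k x y (f y) ∂ν :=
  (hk.memLp_integral f).coeFn_toLp

end IsSchurKernel

end Schur

section Weight

variable {d : ℕ}

theorem weight_add (α β : ℝ) (x : Space d) : weight (α + β) x = weight α x * weight β x :=
  Real.rpow_add (by positivity) α β

theorem weight_sub_comm (α : ℝ) (x y : Space d) : weight α (x - y) = weight α (y - x) := by
  rw [weight, weight, norm_sub_rev]

theorem weight_le_weight {α β : ℝ} (h : α ≤ β) (x : Space d) : weight α x ≤ weight β x :=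
  Real.rpow_le_rpow_of_exponent_le (le_add_of_nonneg_right (sq_nonneg _)) h

theorem one_add_norm_sq_le (x y : Space d) :
    1 + ‖x‖ ^ 2 ≤ 2 * (1 + ‖x - y‖ ^ 2) * (1 + ‖y‖ ^ 2) := by
  have htri : ‖x‖ ≤ ‖x - y‖ + ‖y‖ := by simpa using norm_add_le (x - y) y
  nlinarith [norm_nonneg x, norm_nonneg (x - y), norm_nonneg y, sq_nonneg (‖x - y‖ - ‖y‖),
    mul_nonneg (sq_nonneg ‖x - y‖) (sq_nonneg ‖y‖)]

theorem peetre_of_nonneg {α : ℝ} (hα : 0 ≤ α) (x y : Space d) :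
    weight α x ≤ 2 ^ α * weight α (x - y) * weight α y := by
  simp only [weight]
  rw [← Real.mul_rpow (by norm_num) (by positivity),
    ← Real.mul_rpow (by positivity) (by positivity)]
  exact Real.rpow_le_rpow (by positivity) (one_add_norm_sq_le x y) hα

theorem peetre (α : ℝ) (x y : Space d) :
    weight α x ≤ 2 ^ |α| * weight |α| (x - y) * weight α y := by
  rcases le_total 0 α with hα | hα
  · simpa only [abs_of_nonneg hα] using peetre_of_nonneg hα x y
  · have hswap := peetre_of_nonneg (neg_nonneg.2 hα) y x
    have hwx := (weight_pos α x).le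
    have hwy := (weight_pos α y).le
    rw [abs_of_nonpos hα, weight_sub_comm]
    calc weight α x = weight α x * (weight (-α) y * weight α y) := by
          rw [weight_neg_mul_weight, mul_one]
      _ ≤ weight α x * (2 ^ (-α) * weight (-α) (y - x) * weight (-α) x * weight α y) := by gcongr
      _ = 2 ^ (-α) * weight (-α) (y - x) * weight α y * (weight (-α) x * weight α x) := by ring
      _ = 2 ^ (-α) * weight (-α) (y - x) * weight α y := by rw [weight_neg_mul_weight, mul_one]

theorem weight_mul_weight_sub_le (α s : ℝ) (x y : Space d) :
    weight α x * weight (-s) (x - y) ≤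
      2 ^ |α| * weight (-(s - |α|)) (x - y) * weight α y := by
  have := (weight_pos (-s) (x - y)).le
  calc weight α x * weight (-s) (x - y)
      ≤ 2 ^ |α| * weight |α| (x - y) * weight α y * weight (-s) (x - y) := by
        gcongr
        exact peetre α x y
    _ = 2 ^ |α| * weight (-(s - |α|)) (x - y) * weight α y := by
        rw [neg_sub, sub_eq_add_neg |α| s, weight_add]; ring

theorem lintegral_weight_ne_top {r : ℝ} (hr : (d : ℝ) / 2 < r) :
    ∫⁻ x : Space d, ENNReal.ofReal (weight (-r) x) ≠ ⊤ := by
  have hwint : Integrable (weight (d := d) (-r)) := by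
    convert integrable_rpow_neg_one_add_norm_sq (E := Space d) (μ := volume) (r := 2 * r)
      (by simp; linarith) using 2
    rw [weight]
    ring_nf
  exact ((hasFiniteIntegral_iff_ofReal (ae_of_all _ fun x => (weight_pos _ x).le)).1 hwint.2).ne

end Weight

section LatticeSums

variable {d : ℕ}

theorem toSpace_add (k l : Lattice d) : toSpace (k + l) = toSpace k + toSpace l := by
  ext j; simp [toSpace]

theorem one_le_dist_toSpace {k l : Lattice d} (h : k ≠ l) :
    1 ≤ dist (toSpace k) (toSpace l) := by
  obtain ⟨j, hj⟩ := Function.ne_iff.1 h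
  have hcoord : (1 : ℝ) ≤ |(k j : ℝ) - l j| := by
    exact_mod_cast Int.one_le_abs (sub_ne_zero.2 hj)
  rw [dist_eq_norm]
  exact hcoord.trans (PiLp.norm_apply_le (toSpace k - toSpace l) j)

theorem pairwise_disjoint_ball_toSpace :
    Pairwise (Function.onFun Disjoint fun k : Lattice d => Metric.ball (toSpace k) (1 / 2)) :=
  fun k l hkl => Metric.ball_disjoint_ball (by linarith [one_le_dist_toSpace hkl])

theorem weight_le_two_rpow {α : ℝ} (hα : 0 ≤ α) {x : Space d} (hx : ‖x‖ ≤ 1) :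
    weight α x ≤ 2 ^ α :=
  Real.rpow_le_rpow (by positivity) (by nlinarith [norm_nonneg x]) hα

theorem weight_sub_mul_volume_ball_le (α : ℝ) (x z : Space d) :
    ENNReal.ofReal (weight α (x - z)) * volume (Metric.ball (0 : Space d) (1 / 2)) ≤
      ENNReal.ofReal (2 ^ |α| * 2 ^ |α|) *
        ∫⁻ y in Metric.ball z (1 / 2), ENNReal.ofReal (weight α (x - y)) := by
  have hmeas : Measurable fun y : Space d => ENNReal.ofReal (weight α (x - y)) :=
    (measurable_ofReal_weight α).comp (measurable_const.sub measurable_id)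
  rw [← lintegral_const_mul _ hmeas, ← Measure.addHaar_ball_center volume z, ← setLIntegral_const]
  refine setLIntegral_mono (hmeas.const_mul _) fun y hy => ?_
  rw [← ENNReal.ofReal_mul (by positivity)]
  refine ENNReal.ofReal_le_ofReal ((peetre α (x - z) (x - y)).trans ?_)
  have hdist : ‖x - z - (x - y)‖ ≤ 1 := by
    rw [sub_sub_sub_cancel_left, ← dist_eq_norm]
    linarith [Metric.mem_ball.1 hy]
  have := (weight_pos α (x - y)).le
  gcongr
  exact weight_le_two_rpow (abs_nonneg α) hdist

theorem exists_tsum_weight_sub_le {r : ℝ} (hr : (d : ℝ) / 2 < r) :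
    ∃ A ≠ ⊤, ∀ x : Space d, ∑' k, ENNReal.ofReal (weight (-r) (x - toSpace k)) ≤ A := by
  set v := volume (Metric.ball (0 : Space d) (1 / 2))
  have hv0 : v ≠ 0 := (Metric.measure_ball_pos _ _ (by norm_num)).ne'
  have hvt : v ≠ ⊤ := measure_ball_lt_top.ne
  set c := ENNReal.ofReal (2 ^ |-r| * 2 ^ |-r|)
  refine ⟨c * (∫⁻ y : Space d, ENNReal.ofReal (weight (-r) y)) / v, ENNReal.div_ne_top
    (ENNReal.mul_ne_top ENNReal.ofReal_ne_top (lintegral_weight_ne_top hr)) hv0, fun x => ?_⟩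
  rw [ENNReal.le_div_iff_mul_le (Or.inl hv0) (Or.inl hvt), ← ENNReal.tsum_mul_right]
  calc ∑' k, ENNReal.ofReal (weight (-r) (x - toSpace k)) * v
      ≤ ∑' k, c * ∫⁻ y in Metric.ball (toSpace k) (1 / 2), ENNReal.ofReal (weight (-r) (x - y)) :=
        ENNReal.tsum_le_tsum fun k => weight_sub_mul_volume_ball_le (-r) x (toSpace k)
    _ = c * ∫⁻ y in ⋃ k : Lattice d, Metric.ball (toSpace k) (1 / 2),
          ENNReal.ofReal (weight (-r) (x - y)) := by
        rw [ENNReal.tsum_mul_left, lintegral_iUnion (fun k => measurableSet_ball)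
          pairwise_disjoint_ball_toSpace]
    _ ≤ c * ∫⁻ y, ENNReal.ofReal (weight (-r) (x - y)) := by
        gcongr
        exact Measure.restrict_le_self
    _ = c * ∫⁻ y, ENNReal.ofReal (weight (-r) y) := by
        rw [lintegral_sub_left_eq_self (fun y => ENNReal.ofReal (weight (-r) y)) x]

end LatticeSums

section Decay

variable {d : ℕ} {F : Type*} [NormedAddCommGroup F]

/-- `R` is measurable and bounded by a multiple of `(1 + |x|²)^(-s)`. -/
structure HasPolynomialDecay (R : Space d → F) (s : ℝ) : Prop where
  stronglyMeasurable : StronglyMeasurable R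
  exists_norm_le : ∃ C, ∀ x, ‖R x‖ ≤ C * weight (-s) x

theorem weight_natCast_le (m : ℕ) (x : Space d) : weight m x ≤ (1 + ‖x‖) ^ (2 * m) := by
  rw [weight, Real.rpow_natCast, pow_mul]
  gcongr
  nlinarith [norm_nonneg x]

theorem one_add_pow_mul_exp_neg_le (m : ℕ) {ε t : ℝ} (hε : 0 < ε) (ht : 0 ≤ t) :
    (1 + t) ^ m * Real.exp (-ε * t) ≤ m.factorial * Real.exp ε / ε ^ m := by
  have hexp := Real.pow_div_factorial_le_exp (ε * (1 + t)) (by positivity) m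
  rw [div_le_iff₀ (by positivity), mul_pow] at hexp
  rw [le_div_iff₀ (by positivity)]
  calc (1 + t) ^ m * Real.exp (-ε * t) * ε ^ m
      = ε ^ m * (1 + t) ^ m * Real.exp (-ε * t) := by ring
    _ ≤ Real.exp (ε * (1 + t)) * m.factorial * Real.exp (-ε * t) := by gcongr
    _ = m.factorial * Real.exp (ε * (1 + t) + -ε * t) := by rw [Real.exp_add]; ring
    _ = m.factorial * Real.exp ε := by ring_nf

theorem hasPolynomialDecay_of_norm_le_exp {R : Space d → F} (hm : StronglyMeasurable R)
    {ε C : ℝ} (hε : 0 < ε) (hR : ∀ x, ‖R x‖ ≤ C * Real.exp (-ε * ‖x‖)) (s : ℝ) :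
    HasPolynomialDecay R s := by
  have hC : 0 ≤ C := by simpa using (norm_nonneg _).trans (hR 0)
  set m := ⌈s⌉₊
  refine ⟨hm, C * ((2 * m).factorial * Real.exp ε / ε ^ (2 * m)), fun x => ?_⟩
  have hweight : weight s x ≤ (1 + ‖x‖) ^ (2 * m) :=
    (weight_le_weight (Nat.le_ceil s) x).trans (weight_natCast_le m x)
  have hwneg := (weight_pos (-s) x).le
  calc ‖R x‖ ≤ C * Real.exp (-ε * ‖x‖) * (weight (-s) x * weight s x) := by
        simpa only [weight_neg_mul_weight, mul_one] using hR x
    _ ≤ C * Real.exp (-ε * ‖x‖) * (weight (-s) x * (1 + ‖x‖) ^ (2 * m)) := by gcongr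
    _ = C * ((1 + ‖x‖) ^ (2 * m) * Real.exp (-ε * ‖x‖)) * weight (-s) x := by ring
    _ ≤ C * ((2 * m).factorial * Real.exp ε / ε ^ (2 * m)) * weight (-s) x := by
        gcongr
        exact one_add_pow_mul_exp_neg_le _ hε (norm_nonneg x)

theorem ConditionR1.hasPolynomialDecay {n : ℕ} {R : Space d → EuclideanSpace ℝ (Fin n)}
    (hR : ConditionR1 R) (s : ℝ) : HasPolynomialDecay R s := by
  obtain ⟨hsmooth, ε, hε, C, hC⟩ := hR
  exact hasPolynomialDecay_of_norm_le_exp hsmooth.continuous.stronglyMeasurable hε hC s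

theorem HasPolynomialDecay.exists_weight_mul_enorm_le {R : Space d → F} {s : ℝ}
    (hR : HasPolynomialDecay R s) (α : ℝ) : ∃ c ≠ ⊤, ∀ x y z : Space d, ‖z‖ = ‖x - y‖ →
      ENNReal.ofReal (weight α x) * ‖R z‖ₑ ≤
        c * ENNReal.ofReal (weight (-(s - |α|)) (x - y)) * ENNReal.ofReal (weight α y) := by
  obtain ⟨C, hC⟩ := hR.exists_norm_le
  have hC0 : 0 ≤ C :=
    nonneg_of_mul_nonneg_left ((norm_nonneg _).trans (hC 0)) (weight_pos (-s) 0)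
  refine ⟨ENNReal.ofReal (C * 2 ^ |α|), ENNReal.ofReal_ne_top, fun x y z hz => ?_⟩
  have hwx := weight_pos α x
  have hRz : ‖R z‖ ≤ C * weight (-s) (x - y) := by
    simpa only [weight, hz] using hC z
  rw [← ofReal_norm, ← ENNReal.ofReal_mul hwx.le, ← ENNReal.ofReal_mul (by positivity),
    ← ENNReal.ofReal_mul (mul_nonneg (by positivity) (weight_pos _ _).le)]
  refine ENNReal.ofReal_le_ofReal ?_
  calc weight α x * ‖R z‖ ≤ weight α x * (C * weight (-s) (x - y)) := by gcongr
    _ = C * (weight α x * weight (-s) (x - y)) := by ring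
    _ ≤ C * (2 ^ |α| * weight (-(s - |α|)) (x - y) * weight α y) :=
        mul_le_mul_of_nonneg_left (weight_mul_weight_sub_le α s x y) hC0
    _ = C * 2 ^ |α| * weight (-(s - |α|)) (x - y) * weight α y := by ring

theorem HasPolynomialDecay.exists_lintegral_weight_mul_le {R : Space d → F} {s α : ℝ}
    (hR : HasPolynomialDecay R s) (hs : d / 2 + |α| < s) : ∃ A ≠ ⊤, ∀ y : Space d,
      ∫⁻ x, ENNReal.ofReal (weight α x) * ‖R (x - y)‖ₑ ≤ A * ENNReal.ofReal (weight α y) := by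
  obtain ⟨c, hct, hc⟩ := hR.exists_weight_mul_enorm_le α
  have hI := lintegral_weight_ne_top (d := d) (lt_sub_iff_add_lt.2 hs)
  refine ⟨c * ∫⁻ x, ENNReal.ofReal (weight (-(s - |α|)) (x : Space d)),
    ENNReal.mul_ne_top hct hI, fun y => ?_⟩
  refine (lintegral_mono fun x => hc x y _ rfl).trans_eq ?_
  rw [lintegral_mul_const' _ _ ENNReal.ofReal_ne_top, lintegral_const_mul' _ _ hct,
    lintegral_sub_right_eq_self (fun x => ENNReal.ofReal (weight (-(s - |α|)) x)) y]

theorem HasPolynomialDecay.exists_tsum_weight_mul_le {R : Space d → F} {s α : ℝ}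
    (hR : HasPolynomialDecay R s) (hs : d / 2 + |α| < s) : ∃ A ≠ ⊤, ∀ x : Space d,
      ∑' k, ENNReal.ofReal (weight α (toSpace k)) * ‖R (x - toSpace k)‖ₑ ≤
        A * ENNReal.ofReal (weight α x) := by
  obtain ⟨c, hct, hc⟩ := hR.exists_weight_mul_enorm_le α
  obtain ⟨A, hAt, hA⟩ := exists_tsum_weight_sub_le (d := d) (lt_sub_iff_add_lt.2 hs)
  refine ⟨c * A, ENNReal.mul_ne_top hct hAt, fun x => ?_⟩
  refine (ENNReal.tsum_le_tsum fun k => hc (toSpace k) x _ (norm_sub_rev _ _)).trans ?_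
  rw [ENNReal.tsum_mul_right, ENNReal.tsum_mul_left]
  simp only [weight_sub_comm _ _ x]
  gcongr
  exact hA x

end Decay

section LatticeFunctions

variable {d n : ℕ} {α : ℝ}

instance : SFinite (latticeMeasure d α) :=
  inferInstanceAs (SFinite (Measure.count.withDensity _))

theorem latticeMeasure_ae {p : Lattice d → Prop} (h : ∀ᵐ k ∂latticeMeasure d α, p k)
    (k : Lattice d) : p k :=
  Measure.ae_count_iff.1 ((ae_withDensity_iff (measurable_of_countable _)).1 h) k
    (by simpa using weight_pos α (toSpace k))

theorem lintegral_latticeMeasure (f : Lattice d → ℝ≥0∞) :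
    ∫⁻ k, f k ∂latticeMeasure d α = ∑' k, ENNReal.ofReal (weight α (toSpace k)) * f k := by
  rw [latticeMeasure, lintegral_withDensity_eq_lintegral_mul _ (measurable_of_countable _)
    (measurable_of_countable _), lintegral_count]
  rfl

theorem lintegral_fieldMeasure {f : Space d → ℝ≥0∞} (hf : Measurable f) :
    ∫⁻ x, f x ∂fieldMeasure d α = ∫⁻ x, ENNReal.ofReal (weight α x) * f x := by
  rw [fieldMeasure, lintegral_withDensity_eq_lintegral_mul _ (measurable_ofReal_weight α) hf]
  rfl

theorem norm_lattice_apply_le (u : LatticeSpace d n α) (k : Lattice d) :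
    ‖u k‖ ≤ (√(weight α (toSpace k)))⁻¹ * ‖u‖ := by
  have hw := weight_pos α (toSpace k)
  have hterm : ENNReal.ofReal (weight α (toSpace k)) * ‖u k‖ₑ ^ 2 ≤
      eLpNorm u 2 (latticeMeasure d α) ^ 2 := by
    rw [eLpNorm_two_sq, lintegral_latticeMeasure]
    exact ENNReal.le_tsum k
  have hsq := ENNReal.toReal_mono (ENNReal.pow_ne_top (Lp.eLpNorm_ne_top u)) hterm
  rw [ENNReal.toReal_mul, ENNReal.toReal_ofReal hw.le, ENNReal.toReal_pow, ENNReal.toReal_pow,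
    toReal_enorm, ← Lp.norm_def] at hsq
  rw [inv_mul_eq_div, le_div_iff₀ (Real.sqrt_pos.2 hw)]
  refine le_of_sq_le_sq ?_ (norm_nonneg u)
  rwa [mul_pow, Real.sq_sqrt hw.le, mul_comm]

/-- Evaluation `u ↦ u(k)` at a lattice point. -/
def latticeEval (k : Lattice d) : LatticeSpace d n α →L[ℝ] EuclideanSpace ℝ (Fin n) :=
  LinearMap.mkContinuous
    { toFun := fun u => u k
      map_add' := fun u v => latticeMeasure_ae (Lp.coeFn_add u v) k
      map_smul' := fun a u => latticeMeasure_ae (Lp.coeFn_smul a u) k }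
    _ fun u => norm_lattice_apply_le u k

theorem latticeEval_apply (k : Lattice d) (u : LatticeSpace d n α) : latticeEval k u = u k := rfl

theorem lattice_ext {u v : LatticeSpace d n α} (h : ∀ k, latticeEval k u = latticeEval k v) :
    u = v :=
  Lp.ext (ae_of_all _ h)

theorem enorm_continuousLinearMap_zero {F G : Type*} [NormedAddCommGroup F] [NormedSpace ℝ F]
    [NormedAddCommGroup G] [NormedSpace ℝ G] : ‖(0 : F →L[ℝ] G)‖ₑ = 0 := by
  rw [← ofReal_norm, norm_zero, ENNReal.ofReal_zero]

open Classical in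
theorem isSchurKernel_shift (e : Lattice d) :
    IsSchurKernel (fun k l : Lattice d => if l = k + e then
        ContinuousLinearMap.id ℝ (EuclideanSpace ℝ (Fin n)) else 0)
      (latticeMeasure d α) Measure.count fun l => ENNReal.ofReal (weight α (toSpace l)) where
  stronglyMeasurable := (measurable_of_countable _).stronglyMeasurable
  measurable_weight := measurable_of_countable _
  weight_ne_zero l := by simpa using weight_pos α (toSpace l)
  exists_lintegral_le := by
    refine ⟨‖ContinuousLinearMap.id ℝ (EuclideanSpace ℝ (Fin n))‖ₑ, enorm_ne_top, fun k => ?_⟩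
    simp only [lintegral_count, apply_ite (‖·‖ₑ), enorm_continuousLinearMap_zero, tsum_ite_eq,
      le_refl]
  exists_lintegral_le_weight := by
    refine ⟨ENNReal.ofReal (2 ^ |α| * weight |α| (-toSpace e)) *
      ‖ContinuousLinearMap.id ℝ (EuclideanSpace ℝ (Fin n))‖ₑ,
      ENNReal.mul_ne_top ENNReal.ofReal_ne_top enorm_ne_top, fun l => ?_⟩
    have hweight : weight α (toSpace (l - e)) ≤
        2 ^ |α| * weight |α| (-toSpace e) * weight α (toSpace l) := by
      have hsub : toSpace (l - e) - toSpace l = -toSpace e := by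
        rw [← sub_add_cancel l e, toSpace_add, sub_add_cancel]
        abel
      exact hsub ▸ peetre α (toSpace (l - e)) (toSpace l)
    rw [lintegral_latticeMeasure, tsum_eq_single (l - e) fun k hk => by
      rw [if_neg fun h => hk (eq_sub_of_add_eq h.symm), enorm_continuousLinearMap_zero, mul_zero],
      if_pos (sub_add_cancel l e).symm, mul_right_comm, ← ENNReal.ofReal_mul
        (mul_nonneg (by positivity) (weight_pos _ _).le)]
    gcongr

/-- The shift `u ↦ u(· + e)` on `L^α`. -/
def latticeShift (e : Lattice d) : LatticeSpace d n α →L[ℝ] LatticeSpace d n α :=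
  (isSchurKernel_shift e).toLp

theorem latticeShift_apply (e : Lattice d) (u : LatticeSpace d n α) (k : Lattice d) :
    latticeShift e u k = u (k + e) := by
  classical
  refine (latticeMeasure_ae ((isSchurKernel_shift e).toLp_ae_eq u) k).trans ?_
  beta_reduce
  rw [← setIntegral_eq_integral_of_forall_compl_eq_zero (s := {k + e}) fun l hl => by
    rw [if_neg (mt mem_singleton_iff.2 hl), zero_apply], integral_singleton, if_pos rfl,
      Measure.real,
    Measure.count_singleton, ENNReal.toReal_one, one_smul]
  rfl

/-- The discrete Laplacian as an operator on `L^α`. -/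
def latticeLaplacianCLM : LatticeSpace d n α →L[ℝ] LatticeSpace d n α :=
  ∑ j, ((latticeShift (Pi.single j 1) - ContinuousLinearMap.id ℝ _) +
    (latticeShift (-Pi.single j 1) - ContinuousLinearMap.id ℝ _))

theorem latticeLaplacianCLM_apply (u : LatticeSpace d n α) (k : Lattice d) :
    latticeLaplacianCLM u k = latticeLaplacian u k := by
  simp only [latticeLaplacianCLM, latticeLaplacian, ← latticeEval_apply, sum_apply, map_sum,
    add_apply, map_add, sub_apply, map_sub,
    ContinuousLinearMap.id_apply]
  simp only [latticeEval_apply, latticeShift_apply, sub_eq_add_neg]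

end LatticeFunctions

section Coupling

theorem enorm_innerSL {E : Type*} [NormedAddCommGroup E] [InnerProductSpace ℝ E] (v : E) :
    ‖innerSL ℝ v‖ₑ = ‖v‖ₑ :=
  enorm_eq_iff_norm_eq.2 (innerSL_apply_norm ℝ v)

theorem enorm_toSpanSingleton {E : Type*} [NormedAddCommGroup E] [NormedSpace ℝ E] (v : E) :
    ‖ContinuousLinearMap.toSpanSingleton ℝ v‖ₑ = ‖v‖ₑ :=
  enorm_eq_iff_norm_eq.2 (ContinuousLinearMap.norm_toSpanSingleton v)

theorem weight_exponent_zero {d : ℕ} (x : Space d) : weight 0 x = 1 := Real.rpow_zero _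

variable {d n : ℕ} {α s : ℝ} {R : Space d → EuclideanSpace ℝ (Fin n)}

theorem HasPolynomialDecay.stronglyMeasurable_sub (hR : HasPolynomialDecay R s) :
    StronglyMeasurable fun p : Space d × Lattice d => R (p.1 - toSpace p.2) :=
  hR.stronglyMeasurable.comp_measurable
    (measurable_fst.sub ((measurable_of_countable toSpace).comp measurable_snd))

theorem HasPolynomialDecay.isSchurKernel_coupling (hR : HasPolynomialDecay R s)
    (hs : d / 2 + |α| < s) :
    IsSchurKernel (fun (x : Space d) (k : Lattice d) => innerSL ℝ (R (x - toSpace k)))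
      (fieldMeasure d α) Measure.count fun k => ENNReal.ofReal (weight α (toSpace k)) where
  stronglyMeasurable :=
    (innerSL ℝ).continuous.comp_stronglyMeasurable hR.stronglyMeasurable_sub
  measurable_weight := measurable_of_countable _
  weight_ne_zero k := by simpa using weight_pos α (toSpace k)
  exists_lintegral_le := by
    obtain ⟨A, hA, hle⟩ := hR.exists_tsum_weight_mul_le (α := 0)
      ((by simp [abs_nonneg] : d / 2 + |(0 : ℝ)| ≤ d / 2 + |α|).trans_lt hs)
    refine ⟨A, hA, fun x => ?_⟩
    simpa only [lintegral_count, enorm_innerSL, weight_exponent_zero, ENNReal.ofReal_one,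
      one_mul, mul_one] using hle x
  exists_lintegral_le_weight := by
    obtain ⟨A, hA, hle⟩ := hR.exists_lintegral_weight_mul_le hs
    refine ⟨A, hA, fun k => ?_⟩
    have hmeas : Measurable fun x => ‖R (x - toSpace k)‖ₑ :=
      (hR.stronglyMeasurable.comp_measurable (measurable_id.sub_const _)).enorm
    simpa only [enorm_innerSL, lintegral_fieldMeasure hmeas] using hle (toSpace k)

theorem HasPolynomialDecay.isSchurKernel_couplingAdj (hR : HasPolynomialDecay R s)
    (hs : d / 2 + |α| < s) :
    IsSchurKernel (fun (k : Lattice d) (x : Space d) =>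
        ContinuousLinearMap.toSpanSingleton ℝ (R (x - toSpace k)))
      (latticeMeasure d α) volume fun x => ENNReal.ofReal (weight α x) where
  stronglyMeasurable :=
    (ContinuousLinearMap.toSpanSingletonCLE (𝕜 := ℝ)).continuous.comp_stronglyMeasurable
      (hR.stronglyMeasurable_sub.comp_measurable measurable_swap)
  measurable_weight := measurable_ofReal_weight α
  weight_ne_zero x := by simpa using weight_pos α x
  exists_lintegral_le := by
    obtain ⟨A, hA, hle⟩ := hR.exists_lintegral_weight_mul_le (α := 0)
      ((by simp [abs_nonneg] : d / 2 + |(0 : ℝ)| ≤ d / 2 + |α|).trans_lt hs)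
    refine ⟨A, hA, fun k => ?_⟩
    simpa only [enorm_toSpanSingleton, weight_exponent_zero, ENNReal.ofReal_one, one_mul, mul_one]
      using hle (toSpace k)
  exists_lintegral_le_weight := by
    obtain ⟨A, hA, hle⟩ := hR.exists_tsum_weight_mul_le hs
    refine ⟨A, hA, fun x => ?_⟩
    simpa only [lintegral_latticeMeasure, enorm_toSpanSingleton] using hle x

/-- The coupling `S` as an operator from `L^α` to `H^{0,α}`. -/
def couplingCLM (hR : HasPolynomialDecay R s) (hs : d / 2 + |α| < s) :
    LatticeSpace d n α →L[ℝ] H0 d α :=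
  (hR.isSchurKernel_coupling hs).toLp

theorem couplingCLM_ae_eq (hR : HasPolynomialDecay R s) (hs : d / 2 + |α| < s)
    (u : LatticeSpace d n α) : ∀ᵐ x, couplingCLM hR hs u x = couplingS R u x := by
  have hk := hR.isSchurKernel_coupling hs
  refine fieldMeasure_ae (α := α) ?_
  filter_upwards [hk.toLp_ae_eq u, hk.ae_integrable u] with x hx hintegrable
  refine hx.trans ((integral_countable hintegrable).trans (tsum_congr fun k => ?_))
  rw [Measure.real, Measure.count_singleton, ENNReal.toReal_one, one_smul]
  rfl

/-- The coupling `S^*` as an operator from `H^{0,α}` to `L^α`. -/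
def couplingAdjCLM (hR : HasPolynomialDecay R s) (hs : d / 2 + |α| < s) :
    H0 d α →L[ℝ] LatticeSpace d n α :=
  (hR.isSchurKernel_couplingAdj hs).toLp

theorem couplingAdjCLM_apply (hR : HasPolynomialDecay R s) (hs : d / 2 + |α| < s)
    (ψ : H0 d α) (k : Lattice d) : couplingAdjCLM hR hs ψ k = couplingSAdj R ψ k :=
  latticeMeasure_ae ((hR.isSchurKernel_couplingAdj hs).toLp_ae_eq ψ) k

end Coupling

/-! ### The field–crystal system -/

section Components

variable {d n : ℕ} {α : ℝ}

-- Shortcut instances: unfolding the nested product during instance search is prohibitively slow.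
instance : NormedAddCommGroup (PhaseSpace d n α) := inferInstance

instance : InnerProductSpace ℝ (PhaseSpace d n α) := inferInstance

instance : NormedSpace ℝ (PhaseSpace d n α) := inferInstance

/-- The field component `(ψ, u, π, v) ↦ ψ` of the phase space. -/
def fieldCLM : PhaseSpace d n α →L[ℝ] H1 d α := (WithLp.fstL 2 ℝ _ _).comp (WithLp.fstL 2 ℝ _ _)

/-- The displacement component `(ψ, u, π, v) ↦ u` of the phase space. -/
def dispCLM : PhaseSpace d n α →L[ℝ] LatticeSpace d n α :=
  (WithLp.sndL 2 ℝ _ _).comp (WithLp.fstL 2 ℝ _ _)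

/-- The momentum component `(ψ, u, π, v) ↦ π` of the phase space. -/
def momCLM : PhaseSpace d n α →L[ℝ] H0 d α := (WithLp.fstL 2 ℝ _ _).comp (WithLp.sndL 2 ℝ _ _)

/-- The velocity component `(ψ, u, π, v) ↦ v` of the phase space. -/
def velCLM : PhaseSpace d n α →L[ℝ] LatticeSpace d n α :=
  (WithLp.sndL 2 ℝ _ _).comp (WithLp.sndL 2 ℝ _ _)

/-- The phase-space vector `(ψ, u, π, v)`. -/
def phaseMk (ψ : H1 d α) (u : LatticeSpace d n α) (π : H0 d α) (v : LatticeSpace d n α) :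
    PhaseSpace d n α :=
  WithLp.toLp 2 (WithLp.toLp 2 (ψ, u), WithLp.toLp 2 (π, v))

theorem phaseSpace_inner_eq (Y Z : PhaseSpace d n α) : inner ℝ Y Z =
    inner ℝ (fieldCLM Y) (fieldCLM Z) + inner ℝ (dispCLM Y) (dispCLM Z) +
      (inner ℝ (momCLM Y) (momCLM Z) + inner ℝ (velCLM Y) (velCLM Z)) := by
  rw [WithLp.prod_inner_apply, WithLp.prod_inner_apply, WithLp.prod_inner_apply]
  rfl

theorem phaseSpace_norm_sq_eq (Y : PhaseSpace d n α) : ‖Y‖ ^ 2 =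
    ‖fieldCLM Y‖ ^ 2 + ‖dispCLM Y‖ ^ 2 + (‖momCLM Y‖ ^ 2 + ‖velCLM Y‖ ^ 2) := by
  simp only [← real_inner_self_eq_norm_sq, phaseSpace_inner_eq]

theorem phaseSpace_ext {Y Z : PhaseSpace d n α} (hfield : fieldCLM Y = fieldCLM Z)
    (hdisp : dispCLM Y = dispCLM Z) (hmom : momCLM Y = momCLM Z) (hvel : velCLM Y = velCLM Z) :
    Y = Z := by
  refine sub_eq_zero.1 (norm_eq_zero.1 (pow_eq_zero_iff two_ne_zero |>.1 ?_))
  simp [phaseSpace_norm_sq_eq, hfield, hdisp, hmom, hvel]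

/-- The map into the phase space with given components. -/
def phaseCLM {E : Type*} [NormedAddCommGroup E] [NormedSpace ℝ E] (ψ : E →L[ℝ] H1 d α)
    (u : E →L[ℝ] LatticeSpace d n α) (π : E →L[ℝ] H0 d α) (v : E →L[ℝ] LatticeSpace d n α) :
    E →L[ℝ] PhaseSpace d n α where
  toFun x := phaseMk (ψ x) (u x) (π x) (v x)
  map_add' x y := phaseSpace_ext (map_add ψ x y) (map_add u x y) (map_add π x y) (map_add v x y)
  map_smul' c x := phaseSpace_ext (map_smul ψ c x) (map_smul u c x) (map_smul π c x)
    (map_smul v c x)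
  cont := by
    unfold phaseMk
    fun_prop

end Components

section FreeWave

variable {d n : ℕ} {α : ℝ}

theorem IsTest.laplacian {φ : Space d → ℝ} (hφ : IsTest φ) : IsTest (Δ φ) := by
  let trace : (Space d [×2]→L[ℝ] ℝ) → ℝ := fun m =>
    ∑ i, m ![stdOrthonormalBasis ℝ _ i, stdOrthonormalBasis ℝ _ i]
  have hΔ : Δ φ = trace ∘ iteratedFDeriv ℝ 2 φ :=
    InnerProductSpace.laplacian_eq_iteratedFDeriv_stdOrthonormalBasis φ
  have htrace : ContDiff ℝ ∞ trace := ContDiff.sum fun i _ =>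
    (ContinuousMultilinearMap.apply ℝ (fun _ : Fin 2 => Space d) ℝ _).contDiff
  rw [hΔ]
  exact ⟨htrace.comp (hφ.1.iteratedFDeriv_right le_rfl),
    (hφ.2.iteratedFDeriv (𝕜 := ℝ) 2).comp_left Finset.sum_const_zero⟩

/-- The weak form of the free system `ψ' = π`, `u' = 0`, `π' = Δψ`, `v' = 0`: a pair `(l, l')`
stands for the equation `(l ∘ Y)' = l' ∘ Y`. -/
def freeEqs (d n : ℕ) (α : ℝ) :
    Set ((PhaseSpace d n α →L[ℝ] ℝ) × (PhaseSpace d n α →L[ℝ] ℝ)) :=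
  {l | (∃ φ, ∃ hφ : IsTest φ,
      l = (hφ.pairing.comp (H1.value.comp fieldCLM), hφ.pairing.comp momCLM)) ∨
    (∃ k a, l = ((innerSL ℝ a).comp ((latticeEval k).comp dispCLM), 0)) ∨
    (∃ φ, ∃ hφ : IsTest φ,
      l = (hφ.pairing.comp momCLM, hφ.laplacian.pairing.comp (H1.value.comp fieldCLM))) ∨
    ∃ k a, l = ((innerSL ℝ a).comp ((latticeEval k).comp velCLM), 0)}

theorem forall_mem_freeEqs {P : (PhaseSpace d n α →L[ℝ] ℝ) → (PhaseSpace d n α →L[ℝ] ℝ) → Prop} :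
    (∀ l ∈ freeEqs d n α, P l.1 l.2) ↔
      (∀ φ, ∀ hφ : IsTest φ,
        P (hφ.pairing.comp (H1.value.comp fieldCLM)) (hφ.pairing.comp momCLM)) ∧
      (∀ k a, P ((innerSL ℝ a).comp ((latticeEval k).comp dispCLM)) 0) ∧
      (∀ φ, ∀ hφ : IsTest φ,
        P (hφ.pairing.comp momCLM) (hφ.laplacian.pairing.comp (H1.value.comp fieldCLM))) ∧
      ∀ k a, P ((innerSL ℝ a).comp ((latticeEval k).comp velCLM)) 0 := by
  constructor
  · intro h
    exact ⟨fun φ hφ => h _ (.inl ⟨φ, hφ, rfl⟩), fun k a => h _ (.inr (.inl ⟨k, a, rfl⟩)),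
      fun φ hφ => h _ (.inr (.inr (.inl ⟨φ, hφ, rfl⟩))),
      fun k a => h _ (.inr (.inr (.inr ⟨k, a, rfl⟩)))⟩
  · rintro ⟨hfield, hdisp, hmom, hvel⟩ l (⟨φ, hφ, rfl⟩ | ⟨k, a, rfl⟩ | ⟨φ, hφ, rfl⟩ | ⟨k, a, rfl⟩)
    exacts [hfield φ hφ, hdisp k a, hmom φ hφ, hvel k a]

theorem H0.eq_iff_forall_pairing_eq {f g : H0 d α} :
    f = g ↔ ∀ φ, ∀ hφ : IsTest φ, hφ.pairing f = hφ.pairing g :=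
  ⟨fun h _ _ => h ▸ rfl, fun h => sub_eq_zero.1 <| H0.eq_zero_of_forall_pairing_eq_zero
    fun φ hφ => by rw [map_sub, h φ hφ, sub_self]⟩

theorem lattice_eq_zero_iff {u : LatticeSpace d n α} :
    u = 0 ↔ ∀ k a, inner ℝ a (latticeEval k u) = 0 :=
  ⟨fun h k a => by rw [h, map_zero, inner_zero_right], fun h => lattice_ext fun k => by
    rw [map_zero]
    exact inner_self_eq_zero.1 (h k _)⟩

theorem mem_weakGraph_freeEqs {p : PhaseSpace d n α × PhaseSpace d n α} :
    p ∈ weakGraph (freeEqs d n α) ↔ H1.value (fieldCLM p.2) = momCLM p.1 ∧ dispCLM p.2 = 0 ∧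
      IsWeakDivergence (H1.grad (fieldCLM p.1)) (momCLM p.2) ∧ velCLM p.2 = 0 := by
  rw [mem_weakGraph, forall_mem_freeEqs (P := fun l l' => l p.2 = l' p.1),
    H0.eq_iff_forall_pairing_eq, lattice_eq_zero_iff, lattice_eq_zero_iff,
    H1.isWeakDivergence_iff_integral_laplacian]
  have hzero (x : ℝ) : x = (0 : PhaseSpace d n α →L[ℝ] ℝ) p.1 ↔ x = 0 := Iff.rfl
  simp only [hzero, ContinuousLinearMap.comp_apply, innerSL_apply_apply, IsTest.pairing_apply]

theorem abs_inner_le_of_mem_weakGraph_freeEqs {p : PhaseSpace d n α × PhaseSpace d n α}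
    (hp : p ∈ weakGraph (freeEqs d n α)) : |inner ℝ p.2 p.1| ≤ (1 + |α|) * ‖p.1‖ ^ 2 := by
  obtain ⟨hvalue, hdisp, hdiv, hvel⟩ := mem_weakGraph_freeEqs.1 hp
  set ψ := fieldCLM p.1
  set π := momCLM p.1
  have hinner : inner ℝ p.2 p.1 = inner ℝ π (H1.value ψ) - inner ℝ (drift d α (H1.grad ψ)) π := by
    have htest := H1.isWeightedDivergence_iff.2 hdiv (fieldCLM p.2)
    rw [hvalue] at htest
    rw [phaseSpace_inner_eq, H1.inner_eq, hvalue, hdisp, hvel, inner_zero_left, inner_zero_left,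
      real_inner_comm (H1.grad ψ)]
    linear_combination htest
  have hnorm := phaseSpace_norm_sq_eq p.1
  rw [H1.norm_sq_eq] at hnorm
  have hfield : |inner ℝ π (H1.value ψ)| ≤ ‖p.1‖ ^ 2 := by
    nlinarith [abs_real_inner_le_norm π (H1.value ψ), two_mul_le_add_sq ‖π‖ ‖H1.value ψ‖,
      sq_nonneg ‖H1.grad ψ‖, sq_nonneg ‖dispCLM p.1‖, sq_nonneg ‖velCLM p.1‖]
  have hdrift : |inner ℝ (drift d α (H1.grad ψ)) π| ≤ |α| * ‖p.1‖ ^ 2 := by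
    have hmul : ‖H1.grad ψ‖ * ‖π‖ ≤ ‖p.1‖ ^ 2 := by
      nlinarith [two_mul_le_add_sq ‖H1.grad ψ‖ ‖π‖, sq_nonneg ‖H1.value ψ‖,
        sq_nonneg ‖dispCLM p.1‖, sq_nonneg ‖velCLM p.1‖]
    calc |inner ℝ (drift d α (H1.grad ψ)) π| ≤ |α| * ‖H1.grad ψ‖ * ‖π‖ :=
          (abs_real_inner_le_norm _ _).trans (by gcongr; exact norm_drift_le _)
      _ ≤ |α| * ‖p.1‖ ^ 2 := by rw [mul_assoc]; gcongr
  rw [hinner, add_mul, one_mul]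
  exact (abs_sub _ _).trans (add_le_add hfield hdrift)

/-- Eliminating `π = λψ - z_ψ` reduces the resolvent equation to `λ²ψ - Δψ = λ z_ψ + z_π`. -/
theorem exists_mem_weakGraph_freeEqs {lam : ℝ} (hlam : 1 + |α| < |lam|) (z : PhaseSpace d n α) :
    ∃ p ∈ weakGraph (freeEqs d n α), lam • p.1 - p.2 = z := by
  have hlam0 : lam ≠ 0 := abs_pos.1 (lt_trans (by positivity) hlam)
  have hsq : 1 + α ^ 2 ≤ lam ^ 2 := by
    rw [← sq_abs lam, ← sq_abs α]
    nlinarith [abs_nonneg α]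
  obtain ⟨ψ, hψ⟩ := exists_isWeightedDivergence hsq (lam • H1.value (fieldCLM z) + momCLM z)
  refine ⟨(phaseMk ψ (lam⁻¹ • dispCLM z) (lam • H1.value ψ - H1.value (fieldCLM z))
      (lam⁻¹ • velCLM z),
    phaseMk (lam • ψ - fieldCLM z) 0
      (lam ^ 2 • H1.value ψ - (lam • H1.value (fieldCLM z) + momCLM z)) 0),
    mem_weakGraph_freeEqs.2 ⟨rfl, rfl, hψ.isWeakDivergence, rfl⟩, phaseSpace_ext ?_ ?_ ?_ ?_⟩
  · change lam • ψ - (lam • ψ - fieldCLM z) = fieldCLM z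
    abel
  · change lam • lam⁻¹ • dispCLM z - 0 = dispCLM z
    rw [sub_zero, smul_inv_smul₀ hlam0]
  · change lam • (lam • H1.value ψ - H1.value (fieldCLM z)) -
      (lam ^ 2 • H1.value ψ - (lam • H1.value (fieldCLM z) + momCLM z)) = momCLM z
    module
  · change lam • lam⁻¹ • velCLM z - 0 = velCLM z
    rw [sub_zero, smul_inv_smul₀ hlam0]

theorem eq_zero_of_mem_weakGraph_freeEqs {y : PhaseSpace d n α}
    (hy : (0, y) ∈ weakGraph (freeEqs d n α)) : y = 0 := by
  obtain ⟨hvalue, hdisp, hdiv, hvel⟩ := mem_weakGraph_freeEqs.1 hy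
  have hfield : fieldCLM y = 0 := H1.eq_zero_of_value_eq_zero (by rw [hvalue, map_zero])
  have hmom : momCLM y = 0 := H0.eq_zero_of_forall_pairing_eq_zero fun φ hφ => by
    have h := isWeakDivergence_iff.1 hdiv φ hφ
    rwa [map_zero, map_zero, map_zero, zero_eq_neg] at h
  exact phaseSpace_ext (hfield.trans (map_zero _).symm) (hdisp.trans (map_zero _).symm)
    (hmom.trans (map_zero _).symm) (hvel.trans (map_zero _).symm)

theorem isGroupGenerator_freeEqs : IsGroupGenerator (weakGraph (freeEqs d n α)) (1 + ‖α‖₊) :=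
  isGroupGenerator_of_abs_inner_le
    (fun _ hp => by simpa using abs_inner_le_of_mem_weakGraph_freeEqs hp)
    ⟨1 + |α|, fun _ hlam z => exists_mem_weakGraph_freeEqs hlam z⟩
    fun _ hy => eq_zero_of_mem_weakGraph_freeEqs hy

end FreeWave

section CauchyProblem

theorem hasDerivAt_iff_forall_inner {E : Type*} [NormedAddCommGroup E] [InnerProductSpace ℝ E]
    [FiniteDimensional ℝ E] {f : ℝ → E} {f' : E} {t : ℝ} :
    HasDerivAt f f' t ↔ ∀ a, HasDerivAt (fun s => inner ℝ a (f s)) (inner ℝ a f') t := by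
  refine ⟨fun h a => (innerSL ℝ a).hasFDerivAt.comp_hasDerivAt t h, fun h => ?_⟩
  let b := stdOrthonormalBasis ℝ E
  have hsum : HasDerivAt (fun s => ∑ i, inner ℝ (b i) (f s) • b i)
      (∑ i, inner ℝ (b i) f' • b i) t :=
    HasDerivAt.fun_sum fun i _ => (h (b i)).smul_const (b i)
  simpa only [b.sum_repr'] using hsum

variable {d n : ℕ} {α s : ℝ} {R : Space d → EuclideanSpace ℝ (Fin n)}

/-- The bounded part `(ψ, u, π, v) ↦ (0, v, -m₀² ψ - S u, Δ_L u - ν₀² u - S^* ψ)` of the generator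
of the coupled system. -/
def boundedPart (m₀ ν₀ : ℝ) (hR : HasPolynomialDecay R s) (hs : d / 2 + |α| < s) :
    PhaseSpace d n α →L[ℝ] PhaseSpace d n α :=
  phaseCLM 0 velCLM
    (-(m₀ ^ 2 • H1.value.comp fieldCLM) - (couplingCLM hR hs).comp dispCLM)
    (latticeLaplacianCLM.comp dispCLM - ν₀ ^ 2 • dispCLM -
      (couplingAdjCLM hR hs).comp (H1.value.comp fieldCLM))

variable {m₀ ν₀ : ℝ} {hR : HasPolynomialDecay R s} {hs : d / 2 + |α| < s}

theorem fieldCLM_boundedPart (Y : PhaseSpace d n α) : fieldCLM (boundedPart m₀ ν₀ hR hs Y) = 0 :=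
  rfl

theorem dispCLM_boundedPart (Y : PhaseSpace d n α) :
    dispCLM (boundedPart m₀ ν₀ hR hs Y) = velCLM Y :=
  rfl

theorem momCLM_boundedPart (Y : PhaseSpace d n α) : momCLM (boundedPart m₀ ν₀ hR hs Y) =
    -(m₀ ^ 2 • H1.value (fieldCLM Y)) - couplingCLM hR hs (dispCLM Y) :=
  rfl

theorem velCLM_boundedPart (Y : PhaseSpace d n α) : velCLM (boundedPart m₀ ν₀ hR hs Y) =
    latticeLaplacianCLM (dispCLM Y) - ν₀ ^ 2 • dispCLM Y -
      couplingAdjCLM hR hs (H1.value (fieldCLM Y)) :=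
  rfl

theorem latticeEval_velCLM_boundedPart (k : Lattice d) (Y : PhaseSpace d n α) :
    latticeEval k (velCLM (boundedPart m₀ ν₀ hR hs Y)) =
      latticeLaplacian (dispOf Y) k - ν₀ ^ 2 • dispOf Y k - couplingSAdj R (fieldOf Y) k := by
  rw [velCLM_boundedPart, map_sub, map_sub, map_smul, latticeEval_apply, latticeEval_apply,
    latticeEval_apply, latticeLaplacianCLM_apply, couplingAdjCLM_apply]
  rfl

theorem pairing_momCLM_boundedPart {φ : Space d → ℝ} (hφ : IsTest φ) (Y : PhaseSpace d n α) :
    hφ.laplacian.pairing (H1.value (fieldCLM Y)) +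
        hφ.pairing (momCLM (boundedPart m₀ ν₀ hR hs Y)) =
      (∫ x, fieldOf Y x * (Δ φ x - m₀ ^ 2 * φ x)) - ∫ x, couplingS R (dispOf Y) x * φ x := by
  have hfree : ∫ x, fieldOf Y x * (Δ φ x - m₀ ^ 2 * φ x) =
      hφ.laplacian.pairing (H1.value (fieldCLM Y)) -
        m₀ ^ 2 * hφ.pairing (H1.value (fieldCLM Y)) := by
    have hψ := Lp.memLp (H1.value (fieldCLM Y))
    simp only [IsTest.pairing_apply, mul_sub, mul_left_comm _ (m₀ ^ 2)]
    rw [← integral_const_mul, ← integral_sub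
      (integrable_mul_of_compact hψ hφ.laplacian.1.continuous hφ.laplacian.2)
      ((integrable_mul_of_compact hψ hφ.1.continuous hφ.2).const_mul _)]
    rfl
  have hcoupling : ∫ x, couplingS R (dispOf Y) x * φ x =
      hφ.pairing (couplingCLM hR hs (dispCLM Y)) := by
    rw [IsTest.pairing_apply]
    refine integral_congr_ae ?_
    filter_upwards [couplingCLM_ae_eq hR hs (dispCLM Y)] with x hx
    rw [hx]
    rfl
  rw [momCLM_boundedPart, map_sub, map_neg, map_smul, smul_eq_mul, hfree, hcoupling]
  ring

variable (hR hs) in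
theorem isSolution_iff {Y₀ : PhaseSpace d n α} {Y : ℝ → PhaseSpace d n α} (hY : Continuous Y) :
    IsSolution R m₀ ν₀ Y₀ Y ↔ Y 0 = Y₀ ∧
      IsMildSolutionOn (perturb (weakGraph (freeEqs d n α)) (boundedPart m₀ ν₀ hR hs)) univ Y := by
  rw [isMildSolutionOn_perturb_weakGraph_iff hY, forall_mem_freeEqs (P := fun l l' => ∀ t,
    HasDerivAt (fun s => l (Y s)) (l' (Y t) + l (boundedPart m₀ ν₀ hR hs (Y t))) t)]
  simp only [ContinuousLinearMap.comp_apply, innerSL_apply_apply, zero_apply, zero_add,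
    fieldCLM_boundedPart, dispCLM_boundedPart, pairing_momCLM_boundedPart,
    latticeEval_velCLM_boundedPart, map_zero, add_zero]
  simp only [IsTest.pairing_apply, latticeEval_apply,
    forall_comm (α := EuclideanSpace ℝ (Fin n)) (β := ℝ), ← hasDerivAt_iff_forall_inner]
  exact ⟨fun ⟨hinit, hfield, hdisp, hmom, hvel⟩ => ⟨hinit, hfield, hdisp, hmom, hvel⟩,
    fun ⟨hinit, hfield, hdisp, hmom, hvel⟩ => ⟨hinit, hfield, hdisp, hmom, hvel⟩⟩

end CauchyProblem

end FieldCrystal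

end

open FieldCrystal NNReal in
theorem propositionp1p1_general {d n : ℕ} {α s : ℝ} (m₀ ν₀ : ℝ)
    {R : Space d → EuclideanSpace ℝ (Fin n)} (hR : HasPolynomialDecay R s)
    (hs : d / 2 + |α| < s) :
    (∀ Y₀ : PhaseSpace d n α, ∃! Y : C(ℝ, PhaseSpace d n α), IsSolution R m₀ ν₀ Y₀ Y) ∧
    ∃ c : ℝ≥0, ∀ W : ℝ → PhaseSpace d n α → PhaseSpace d n α,
      (∀ Y₀, Continuous (fun t => W t Y₀) ∧ IsSolution R m₀ ν₀ Y₀ (fun t => W t Y₀)) →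
      (∀ t, Continuous (W t)) ∧ ∀ Y₀ t, ‖W t Y₀‖ ≤ Real.exp (c * |t|) * ‖Y₀‖ := by
  let B : PhaseSpace d n α →L[ℝ] PhaseSpace d n α := boundedPart m₀ ν₀ hR hs
  have hgen := isGroupGenerator_freeEqs.perturb B
  refine ⟨fun Y₀ => ?_, 2 * (1 + ‖α‖₊ + ‖B‖₊), fun W hW => ?_⟩
  · simpa only [isSolution_iff hR hs (ContinuousMap.continuous _)]
      using hgen.existsUnique_isMildSolutionOn_univ Y₀
  · have hWc Y₀ := (hW Y₀).1
    have hWmild Y₀ := (isSolution_iff hR hs (hWc Y₀)).1 (hW Y₀).2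
    refine ⟨hgen.continuous_of_isMildSolutionOn_univ hWc (fun Y₀ => (hWmild Y₀).2)
      fun Y₀ => (hWmild Y₀).1, fun Y₀ t => ?_⟩
    have hbound := hgen.norm_le_of_isMildSolutionOn_univ (hWc Y₀) (hWmild Y₀).2 t
    rwa [(hWmild Y₀).1] at hbound

theorem propositionp1p1 (d n : ℕ) (α : ℝ) (hα : α < -(d : ℝ) / 2)
    (m₀ ν₀ : ℝ) (hm₀ : 0 < m₀) (hν₀ : 0 < ν₀)
    (R : FieldCrystal.Space d → EuclideanSpace ℝ (Fin n))
    (hR1 : FieldCrystal.ConditionR1 R) (hR2 : FieldCrystal.ConditionR2 R m₀ ν₀) :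
    (∀ Y₀ : FieldCrystal.PhaseSpace d n α,
      ∃! Y : C(ℝ, FieldCrystal.PhaseSpace d n α), FieldCrystal.IsSolution R m₀ ν₀ Y₀ Y) ∧
    ∀ W : ℝ → FieldCrystal.PhaseSpace d n α → FieldCrystal.PhaseSpace d n α,
      (∀ Y₀, Continuous (fun t => W t Y₀) ∧
        FieldCrystal.IsSolution R m₀ ν₀ Y₀ (fun t => W t Y₀)) →
      (∀ t, Continuous (W t)) ∧
      ((∃ a : ℤ, Even a ∧ a ≤ -2 ∧ α = a) →
        ∀ T > 0, ∃ C : ℝ, ∀ Y₀, ∀ t, |t| ≤ T → ‖W t Y₀‖ ≤ C * ‖Y₀‖) := by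
  obtain ⟨hex, c, hW⟩ := propositionp1p1_general m₀ ν₀
    (hR1.hasPolynomialDecay (d / 2 + |α| + 1)) (lt_add_one (d / 2 + |α|))
  exact ⟨hex, fun W hsol => ⟨(hW W hsol).1, fun _ T _ => ⟨Real.exp (c * T), fun Y₀ t ht =>
    ((hW W hsol).2 Y₀ t).trans (by gcongr)⟩⟩⟩
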